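/- Let $\mathcal{B}=\mathbb{R}\oplus\tau\mathbb{R}$ be the real algebra with $\tau^2=1$, topologised as $\mathbb{R}^2$, and put $e^{\pm}=\frac{1\pm\tau}{2}$, $|a+\tau b|^2=a^2-b^2$ and $\mathcal{C}^+=\{a+\tau b \mid a>0,\ a^2-b^2>0\}$. Decomposing matrices as $A=A^+e^++A^-e^-$ identifies $\mathbb{P}SL(2,\mathcal{B})$ (the quotient of $SL(2,\mathcal{B})$ by its centre $\{\pm1,\pm\tau\}$) with $\mathbb{P}SL(2,\mathbb{R})\times\mathbb{P}SL(2,\mathbb{R})$. An element $A$ of $\mathbb{P}SL(2,\mathcal{B})$ is loxodromic if $A^+$ and $A^-$ are both hyperbolic, semi-loxodromic if one is hyperbolic and the other parabolic, and parabolic if both are parabolic. In these cases its $\mathcal{B}$-length is $$\ell_{\mathcal{B}}(A)=\frac{\ell(A^+)+\ell(A^-)}{2}+\tau\,\frac{\ell(A^+)-\ell(A^-)}{2},\qquad \ell(A^\pm)=2\,\mathrm{arccosh}\Big(\frac{|\mathrm{tr}(A^\pm)|}{2}\Big).$$ Let $\Gamma_{0,3}=\langle r,s,t\mid tsr=e\rangle$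 be the fundamental group of an oriented pair of pants $P$, each generator corresponding to a boundary curve of $P$ oriented so that $P$ lies on its left. A representation $\rho:\Gamma_{0,3}\to\mathbb{P}SL(2,\mathcal{B})$ is called admissible if $\rho(r),\rho(s),\rho(t)$ are each loxodromic, semi-loxodromic or parabolic, and both components $\rho^{+},\rho^{-}:\Gamma_{0,3}\to\mathbb{P}SL(2,\mathbb{R})$ are holonomies of hyperbolic structures on the oriented surface $P$. The latter means that $\rho^\pm$ is discrete and faithful and that, for each $x\in\{r,s,t\}$, one of the following holds: * $\rho^\pm(x)$ is hyperbolic, and the open half-plane $U\subset\mathbb{H}^2$ to the right of its axis (oriented from the repelling to the attracting fixed point) satisfies $\rho^\pm(y)U\cap U=\emptyset$ for all $y\in\Gamma_{0,3}\setminus\langle x\rangle$, so that $x$ is a boundary geodesic of the convex core of $\mathbb{H}^2/\rho^\pm(\Gamma_{0,3})$ with the core on its left; * $\rho^\pm(x)$ is parabolic and conjugate in $\mathbb{P}SL(2,\mathbb{R})$ to $z\mapsto z-1$, so that $x$ goes around a cusp with the cusp on its right. Let $\mathrm{Hom}^{adm}(\Gamma_{0,3},\mathbb{P}SL(2,\mathcal{B}))$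 be the set of admissible representations with the topology of pointwise convergence, and give its quotient by conjugation the quotient topology. Then the map $$F:\mathrm{Hom}^{adm}(\Gamma_{0,3},\mathbb{P}SL(2,\mathcal{B}))/\mathbb{P}SL(2,\mathcal{B})\longrightarrow\big(\overline{\mathcal{C}^+}\big)^3,\qquad [\rho]\mapsto\big(\ell_{\mathcal{B}}(\rho(r)),\ell_{\mathcal{B}}(\rho(s)),\ell_{\mathcal{B}}(\rho(t))\big)$$ is well defined and is a homeomorphism. -/

import Mathlib

open Topology

noncomputable section

namespace AdSPants

/-- The real algebra `𝓑 = ℝ ⊕ τℝ` with `τ² = 1`; `z.re` and `z.im` are the coordinates in the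
basis `1, τ`, and `QuadraticAlgebra.norm z = z.re ^ 2 - z.im ^ 2`. -/
abbrev BAlg : Type := QuadraticAlgebra ℝ 1 0

/-- The topology of `𝓑` as a two-dimensional real vector space. -/
instance : TopologicalSpace BAlg :=
  TopologicalSpace.induced (fun z : BAlg => (z.re, z.im)) inferInstance

/-- The coefficient of `e⁺ = (1 + τ) / 2` in the basis of idempotents `e⁺, e⁻`. -/
def coordPlus : BAlg →+* ℝ where
  toFun z := z.re + z.im
  map_one' := by simp [QuadraticAlgebra.re_one, QuadraticAlgebra.im_one]
  map_zero' := by simp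
  map_mul' x y := by simp [QuadraticAlgebra.re_mul, QuadraticAlgebra.im_mul]; ring
  map_add' x y := by simp; ring

/-- The coefficient of `e⁻ = (1 - τ) / 2` in the basis of idempotents `e⁺, e⁻`. -/
def coordMinus : BAlg →+* ℝ where
  toFun z := z.re - z.im
  map_one' := by simp [QuadraticAlgebra.re_one, QuadraticAlgebra.im_one]
  map_zero' := by simp
  map_mul' x y := by simp [QuadraticAlgebra.re_mul, QuadraticAlgebra.im_mul]; ring
  map_add' x y := by simp; ring

/-- `PSL(2, R) = SL(2, R) / center`. For `R = 𝓑` the center is `{±1, ±τ}`, so that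
`PSL(2, 𝓑)` is `PSL(2, ℝ) × PSL(2, ℝ)`. -/
abbrev PSL2 (R : Type) [CommRing R] : Type :=
  Matrix.SpecialLinearGroup (Fin 2) R ⧸ Subgroup.center (Matrix.SpecialLinearGroup (Fin 2) R)

/-- The class in `PSL(2, R)` of a matrix in `SL(2, R)`. -/
abbrev toPSL2 {R : Type} [CommRing R] (M : Matrix.SpecialLinearGroup (Fin 2) R) : PSL2 R :=
  QuotientGroup.mk M

theorem center_le_comap {R S : Type} [CommRing R] [CommRing S] (f : R →+* S) :
    Subgroup.center (Matrix.SpecialLinearGroup (Fin 2) R) ≤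
      (Subgroup.center (Matrix.SpecialLinearGroup (Fin 2) S)).comap
        (Matrix.SpecialLinearGroup.map f) := by
  intro M hM
  rw [Matrix.SpecialLinearGroup.mem_center_iff] at hM
  obtain ⟨c, hc, hM⟩ := hM
  rw [Subgroup.mem_comap, Matrix.SpecialLinearGroup.mem_center_iff]
  refine ⟨f c, by rw [← map_pow, hc, map_one], ?_⟩
  ext i j
  rw [Matrix.SpecialLinearGroup.map_apply_coe, ← hM]
  fin_cases i <;> fin_cases j <;> simp

/-- The homomorphism `PSL(2, R) → PSL(2, S)` given by a ring homomorphism `R → S`. -/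
def mapPSL2 {R S : Type} [CommRing R] [CommRing S] (f : R →+* S) : PSL2 R →* PSL2 S :=
  QuotientGroup.map _ _ (Matrix.SpecialLinearGroup.map f) (center_le_comap f)

/-- `A = A⁺ e⁺ + A⁻ e⁻ ↦ A⁺`. -/
def projPlus : PSL2 BAlg →* PSL2 ℝ := mapPSL2 coordPlus

/-- `A = A⁺ e⁺ + A⁻ e⁻ ↦ A⁻`. -/
def projMinus : PSL2 BAlg →* PSL2 ℝ := mapPSL2 coordMinus

/-- Hyperbolic elements of `PSL(2, ℝ)`. -/
def IsHyp (A : PSL2 ℝ) : Prop :=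
  ∃ M : Matrix.SpecialLinearGroup (Fin 2) ℝ, toPSL2 M = A ∧ M.1.IsHyperbolic

/-- Parabolic elements of `PSL(2, ℝ)` (the identity is not parabolic). -/
def IsPar (A : PSL2 ℝ) : Prop :=
  ∃ M : Matrix.SpecialLinearGroup (Fin 2) ℝ, toPSL2 M = A ∧ M.1.IsParabolic

/-- Loxodromic: a pair of hyperbolic elements. -/
def IsLoxodromic (A : PSL2 BAlg) : Prop := IsHyp (projPlus A) ∧ IsHyp (projMinus A)

/-- Semi-loxodromic: one hyperbolic and one parabolic element. -/
def IsSemiLoxodromic (A : PSL2 BAlg) : Prop :=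
  (IsHyp (projPlus A) ∧ IsPar (projMinus A)) ∨ (IsPar (projPlus A) ∧ IsHyp (projMinus A))

/-- Parabolic: a pair of parabolic elements. -/
def IsParabolicB (A : PSL2 BAlg) : Prop := IsPar (projPlus A) ∧ IsPar (projMinus A)

theorem abs_trace_eq_of_rel (M N : Matrix.SpecialLinearGroup (Fin 2) ℝ)
    (h : QuotientGroup.leftRel (Subgroup.center (Matrix.SpecialLinearGroup (Fin 2) ℝ)) M N) :
    |M.1.trace| = |N.1.trace| := by
  rw [QuotientGroup.leftRel_apply, Matrix.SpecialLinearGroup.mem_center_iff] at h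
  obtain ⟨c, hc, h⟩ := h
  have hN : N.1 = M.1 * Matrix.scalar (Fin 2) c := by
    rw [h, ← Matrix.SpecialLinearGroup.coe_mul, mul_inv_cancel_left]
  have hc' : |c| = 1 := by
    rw [Fintype.card_fin] at hc
    rcases (mul_self_eq_one_iff (a := c)).mp (by rw [← sq, hc]) with h | h <;> simp [h]
  rw [hN, Matrix.trace_fin_two, Matrix.trace_fin_two]
  simp [← add_mul, abs_mul, hc']

/-- The absolute value of the trace, on `PSL(2, ℝ)`. -/
def absTrace (A : PSL2 ℝ) : ℝ :=
  Quotient.lift (fun M : Matrix.SpecialLinearGroup (Fin 2) ℝ => |M.1.trace|)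
    abs_trace_eq_of_rel A

/-- The hyperbolic translation length `ℓ(A) = 2 arcosh (|tr A| / 2)` of a hyperbolic or parabolic
element; it is `0` in the parabolic case. -/
def hypLength (A : PSL2 ℝ) : ℝ := 2 * Real.arcosh (absTrace A / 2)

/-- The `𝓑`-length `(ℓ(A⁺) + ℓ(A⁻)) / 2 + τ (ℓ(A⁺) - ℓ(A⁻)) / 2 = 2 arcosh (tr A / 2)`. -/
def bLength (A : PSL2 BAlg) : BAlg :=
  ⟨(hypLength (projPlus A) + hypLength (projMinus A)) / 2,
    (hypLength (projPlus A) - hypLength (projMinus A)) / 2⟩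

/-- The cone `𝓒⁺` of space-like elements of `𝓑` with positive real part. -/
def conePlus : Set BAlg := {z | 0 < z.re ∧ 0 < QuadraticAlgebra.norm z}

/-- The relator `t s r`, where `r, s, t` are the generators `0, 1, 2`. -/
def pantsRels : Set (FreeGroup (Fin 3)) :=
  {FreeGroup.of 2 * FreeGroup.of 1 * FreeGroup.of 0}

/-- The fundamental group `⟨r, s, t | t s r = e⟩` of a pair of pants. -/
abbrev PantsGroup : Type := PresentedGroup pantsRels

/-- The generators `r = bdry 0`, `s = bdry 1`, `t = bdry 2`: the oriented boundary curves. -/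
def bdry (i : Fin 3) : PantsGroup := PresentedGroup.of i

/-- The matrix of the translation `z ↦ e^l z` of the upper half-plane; for `l > 0` its axis is the
imaginary half-line, oriented from the repelling point `0` to the attracting point `∞`. -/
def hypMat (l : ℝ) : Matrix.SpecialLinearGroup (Fin 2) ℝ :=
  ⟨!![Real.exp (l / 2), 0; 0, Real.exp (-(l / 2))], by
    rw [Matrix.det_fin_two_of, ← Real.exp_add]; simp⟩

/-- The matrix of the parabolic isometry `z ↦ z - 1` of the upper half-plane. -/
def parMat : Matrix.SpecialLinearGroup (Fin 2) ℝ :=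
  ⟨!![1, -1; 0, 1], by simp⟩

/-- For a representation `ρ` of `G` in `PSL(2, ℝ)` and `x : G`: the curve `x` is a boundary curve
of the quotient surface, oriented so that the surface lies on its left. That is, up to conjugation
in `PSL(2, ℝ)`, one of the following holds.
* `ρ x` is the hyperbolic isometry `z ↦ e^l z` with `l > 0`, and the open half-plane `Re z > 0` on
  the right of its oriented axis is precisely invariant: it is disjoint from its translates by the
  elements of `G` outside `⟨x⟩`. Hence this half-plane covers a funnel of the quotient, bounded by
  the closed geodesic `x`, and the convex core lies on the left of that geodesic.
* `ρ x` is the parabolic isometry `z ↦ z - 1`, which moves along the horocycles `Im z = c` with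
  the cusp `∞` on the right and the rest of the surface on the left. -/
def SurfaceOnLeft {G : Type} [Group G] (ρ : G →* PSL2 ℝ) (x : G) : Prop :=
  (∃ (P : Matrix.SpecialLinearGroup (Fin 2) ℝ) (l : ℝ), 0 < l ∧
    ρ x = toPSL2 (P * hypMat l * P⁻¹) ∧
    ∀ y : G, y ∉ Subgroup.zpowers x →
      ∀ M : Matrix.SpecialLinearGroup (Fin 2) ℝ, toPSL2 M = ρ y →
        ∀ z : UpperHalfPlane, 0 < (P⁻¹ • z).re → ¬ 0 < (P⁻¹ • (M • z)).re) ∨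
  (∃ P : Matrix.SpecialLinearGroup (Fin 2) ℝ, ρ x = toPSL2 (P * parMat * P⁻¹))

/-- Holonomies of hyperbolic structures on the oriented pair of pants with geodesic boundary
curves or cusps: discrete and faithful representations for which `r, s, t` are boundary curves of
the quotient surface, with the surface on the left of each of them. -/
structure IsPantsHolonomy (ρ : PantsGroup →* PSL2 ℝ) : Prop where
  faithful : Function.Injective ρ
  discrete : DiscreteTopology ρ.range
  left : ∀ i, SurfaceOnLeft ρ (bdry i)

/-- Admissible representations of the pants group in `PSL(2, 𝓑)`. -/
structure IsAdmissible (ρ : PantsGroup →* PSL2 BAlg) : Prop where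
  peripheral : ∀ i, IsLoxodromic (ρ (bdry i)) ∨ IsSemiLoxodromic (ρ (bdry i)) ∨
    IsParabolicB (ρ (bdry i))
  plus : IsPantsHolonomy (projPlus.comp ρ)
  minus : IsPantsHolonomy (projMinus.comp ρ)

/-- The set of admissible representations. -/
def AdmHom : Type := {ρ : PantsGroup →* PSL2 BAlg // IsAdmissible ρ}

/-- The topology of pointwise convergence. -/
instance : TopologicalSpace AdmHom :=
  TopologicalSpace.induced (fun (ρ : AdmHom) (x : PantsGroup) => ρ.1 x) inferInstance

/-- Conjugation by elements of `PSL(2, 𝓑)`. -/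
instance conjSetoid : Setoid AdmHom where
  r ρ σ := ∃ g : PSL2 BAlg, ∀ x, σ.1 x = g * ρ.1 x * g⁻¹
  iseqv :=
    { refl := fun _ => ⟨1, fun _ => by simp⟩
      symm := by
        rintro ρ σ ⟨g, h⟩
        exact ⟨g⁻¹, fun x => by rw [h x]; group⟩
      trans := by
        rintro ρ σ κ ⟨g, h⟩ ⟨k, h'⟩
        exact ⟨k * g, fun x => by rw [h' x, h x]; group⟩ }

/-- `Hom^adm(Γ_{0,3}, PSL(2, 𝓑)) / PSL(2, 𝓑)`, with the quotient topology. -/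
abbrev AdmModuli : Type := Quotient conjSetoid

end AdSPants

end

open Topology

noncomputable section

namespace AdSPants

/-! ### The groups `SL(2, R)` and `PSL(2, ℝ)` -/

/-! The idempotents split everything: PSL(2, 𝓑) is PSL(2, ℝ) × PSL(2, ℝ), and the closed cone is the
quadrant of pairs of nonnegative lengths. The claim thus reduces to the classical fact that a
hyperbolic pair of pants is determined by three arbitrary boundary lengths in [0, ∞), together with
continuity of the inverse up to the cusped cases.

Everything rests on one explicit family, `normalForm`. If e spans a fixed direction of t and f = r
e, then in the basis (e, f) the generators r, s become `firstMat x` and `secondMat y v` with x = 2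
cosh(l/2), y = 2 cosh(m/2), v = exp(n/2). No diagonalisation enters, so length 0 is not exceptional
and the inverse map is visibly continuous.

Existence (`isPantsHolonomy_normalRep`): nonzero powers of r send Re ≥ 0 into Re < 0, and nonzero
powers of s send Re ≤ 0 into Re > 0. Ping-pong yields faithfulness, discreteness and the
disjointness condition at r. The automorphism `rotate` permutes the family up to conjugation, which
transfers the condition to s and t.

Uniqueness (`IsPantsHolonomy.exists_conj`): lift r, s to R, S of positive trace. The position of the
surface on the left of its boundary makes `area e (R e)` and `area e (S e)` positive
(`SurfaceOnLeft.exists_eigenvector`). This decides the sign in S R e = -v e; Cayley–Hamilton then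
gives the matrices of R and S in the basis (e, R e), and positivity of the area puts the change of
basis in SL(2, ℝ) after scaling. -/

/-- The group `SL(2, R)`. -/
abbrev SL2 (R : Type) [CommRing R] : Type := Matrix.SpecialLinearGroup (Fin 2) R

theorem toPSL2_eq_iff (M N : SL2 ℝ) : toPSL2 M = toPSL2 N ↔ N = M ∨ N = -M := by
  rw [QuotientGroup.eq, Matrix.SpecialLinearGroup.mem_center_iff]
  constructor
  · rintro ⟨c, hc, h⟩
    have hN : N.1 = M.1 * Matrix.scalar (Fin 2) c := by
      rw [h, ← Matrix.SpecialLinearGroup.coe_mul, mul_inv_cancel_left]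
    rw [Fintype.card_fin, sq, mul_self_eq_one_iff] at hc
    rcases hc with rfl | rfl
    · left; ext i j; simp [hN]
    · right; ext i j; simp [hN]
  · rintro (rfl | rfl)
    · exact ⟨1, by simp, by simp⟩
    · exact ⟨-1, by simp, by ext i j; fin_cases i <;> fin_cases j <;> simp⟩

theorem re_smul (g : SL2 ℝ) (z : UpperHalfPlane) :
    (g • z).re = (g 0 0 * g 1 0 * (z.re ^ 2 + z.im ^ 2) +
      (g 0 0 * g 1 1 + g 0 1 * g 1 0) * z.re + g 0 1 * g 1 1) /
        ((g 1 0 * z.re + g 1 1) ^ 2 + (g 1 0 * z.im) ^ 2) := by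
  have h : (g • z).re = ((g • z : UpperHalfPlane) : ℂ).re := rfl
  rw [h, UpperHalfPlane.coe_specialLinearGroup_apply, Complex.div_re, ← add_div]
  simp [Complex.normSq_apply]
  ring

theorem denom_pos (g : SL2 ℝ) (z : UpperHalfPlane) :
    0 < (g 1 0 * z.re + g 1 1) ^ 2 + (g 1 0 * z.im) ^ 2 := by
  have hz := z.im_pos
  have hd := g.det_coe
  rw [Matrix.det_fin_two] at hd
  by_cases h : g 1 0 = 0
  · have : g 1 1 ≠ 0 := by
      intro h'
      rw [h, h'] at hd; simp at hd
    rw [h]; simp; positivity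
  · positivity

theorem re_smul_pos_iff (g : SL2 ℝ) (z : UpperHalfPlane) :
    0 < (g • z).re ↔ 0 < g 0 0 * g 1 0 * (z.re ^ 2 + z.im ^ 2) +
      (g 0 0 * g 1 1 + g 0 1 * g 1 0) * z.re + g 0 1 * g 1 1 := by
  rw [re_smul, div_pos_iff_of_pos_right (denom_pos g z)]

theorem smul_eq_of_toPSL2_eq {M N : SL2 ℝ} (h : toPSL2 M = toPSL2 N) (z : UpperHalfPlane) :
    M • z = N • z := by
  rcases (toPSL2_eq_iff M N).1 h with rfl | rfl
  · rfl
  · refine UpperHalfPlane.ext ?_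
    simp only [UpperHalfPlane.coe_specialLinearGroup_apply, Matrix.SpecialLinearGroup.coe_neg,
      Matrix.neg_apply, map_neg, Complex.ofReal_neg, neg_mul]
    rw [← neg_add, ← neg_add, neg_div_neg_eq]

/-- Letting t and x tend to 0 bounds r, and large t bounds p. If q were positive with p < 0, the
vertex of the parabola would lie in x > 0, with value -1/(4p) > 0 by the discriminant condition. -/
theorem nonpos_of_forall_pos {p q r : ℝ}
    (h : ∀ x t : ℝ, 0 < x → 0 < t → p * (x ^ 2 + t) + q * x + r ≤ 0) (hd : q ^ 2 - 4 * p * r = 1) :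
    p ≤ 0 ∧ r ≤ 0 ∧ q ≤ 0 := by
  have key : ∀ x : ℝ, 0 < x → p * x ^ 2 + q * x + r ≤ 0 := by
    intro x hx
    have ht : Filter.Tendsto (fun t : ℝ => p * (x ^ 2 + t) + q * x + r) (𝓝[>] 0)
        (𝓝 (p * (x ^ 2 + 0) + q * x + r)) :=
      (Continuous.tendsto (by fun_prop) _).mono_left nhdsWithin_le_nhds
    rw [add_zero] at ht
    exact le_of_tendsto ht (eventually_nhdsWithin_of_forall fun t ht => h x t hx ht)
  have hr : r ≤ 0 := by
    have ht : Filter.Tendsto (fun x : ℝ => p * x ^ 2 + q * x + r) (𝓝[>] 0)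
        (𝓝 (p * 0 ^ 2 + q * 0 + r)) :=
      (Continuous.tendsto (by fun_prop) _).mono_left nhdsWithin_le_nhds
    have := le_of_tendsto ht (eventually_nhdsWithin_of_forall key)
    simpa using this
  have hp : p ≤ 0 := by
    by_contra! hp
    have h1 := h 1 ((|q| + |r|) / p) one_pos
    by_cases h0 : 0 < (|q| + |r|) / p
    · have h2 := h1 h0
      rw [mul_add, mul_div_cancel₀ _ hp.ne'] at h2
      linarith [neg_abs_le q, neg_abs_le r]
    · have h2 := key 1 one_pos
      have : |q| + |r| ≤ 0 := by
        by_contra! h3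
        exact h0 (div_pos h3 hp)
      linarith [neg_abs_le q, neg_abs_le r]
  refine ⟨hp, hr, ?_⟩
  by_contra! hq
  rcases hp.lt_or_eq with hp | rfl
  · have h1 := key (q / (2 * -p)) (by apply div_pos hq; linarith)
    have h2 : p * (q / (2 * -p)) ^ 2 + q * (q / (2 * -p)) + r = -(q ^ 2 - 4 * p * r) / (4 * p) := by
      have := hp.ne
      field_simp
      ring
    rw [h2, hd] at h1
    have : 0 < -1 / (4 * p) := div_pos_of_neg_of_neg (by norm_num) (by linarith)
    linarith
  · have h1 := key ((1 - r) / q) (div_pos (by linarith) hq)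
    rw [mul_div_cancel₀ _ hq.ne'] at h1
    linarith

/-- A matrix in `SL(2, ℝ)` mapping no point of the quadrant `Re z > 0` into that quadrant. -/
theorem entries_of_disjoint (g : SL2 ℝ)
    (h : ∀ z : UpperHalfPlane, 0 < z.re → ¬ 0 < (g • z).re) :
    g 0 0 * g 1 0 ≤ 0 ∧ g 0 1 * g 1 1 ≤ 0 ∧ g 0 0 * g 1 1 + g 0 1 * g 1 0 ≤ 0 := by
  have hd := g.det_coe
  rw [Matrix.det_fin_two] at hd
  refine nonpos_of_forall_pos (fun x t hx ht => ?_) ?_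
  · have h1 := h ⟨⟨x, √t⟩, Real.sqrt_pos.2 ht⟩ hx
    rw [re_smul_pos_iff, not_lt] at h1
    have h2 : (UpperHalfPlane.mk ⟨x, √t⟩ (Real.sqrt_pos.2 ht)).re = x := rfl
    have h3 : (UpperHalfPlane.mk ⟨x, √t⟩ (Real.sqrt_pos.2 ht)).im = √t := rfl
    rwa [h2, h3, Real.sq_sqrt ht.le] at h1
  -- (ad + bc)² - 4(ac)(bd) = (ad - bc)² = 1.
  · linear_combination (g 0 0 * g 1 1 - g 0 1 * g 1 0 + 1) * hd

/-! ### The pants group -/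

/-- The homomorphism from the pants group with prescribed values at `r` and `s`. -/
def pantsHom {G : Type} [Group G] (a b : G) : PantsGroup →* G :=
  PresentedGroup.toGroup (f := ![a, b, (b * a)⁻¹]) (by
    intro w hw
    rw [pantsRels, Set.mem_singleton_iff] at hw
    subst hw
    simp [mul_assoc])

section pantsHom

variable {G : Type} [Group G] (a b : G)

@[simp] theorem pantsHom_bdry_zero : pantsHom a b (bdry 0) = a := PresentedGroup.toGroup.of _

@[simp] theorem pantsHom_bdry_one : pantsHom a b (bdry 1) = b := PresentedGroup.toGroup.of _

@[simp] theorem pantsHom_bdry_two : pantsHom a b (bdry 2) = (b * a)⁻¹ :=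
  PresentedGroup.toGroup.of _

end pantsHom

theorem bdry_two_eq : bdry 2 = (bdry 1 * bdry 0)⁻¹ := by
  have h : (PresentedGroup.mk pantsRels) (FreeGroup.of 2 * FreeGroup.of 1 * FreeGroup.of 0) = 1 :=
    PresentedGroup.one_of_mem (Set.mem_singleton _)
  rw [map_mul, map_mul, mul_assoc] at h
  exact eq_inv_of_mul_eq_one_left h

theorem pantsGroup_hom_ext {G : Type} [Group G] {φ ψ : PantsGroup →* G}
    (h0 : φ (bdry 0) = ψ (bdry 0)) (h1 : φ (bdry 1) = ψ (bdry 1)) : φ = ψ := by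
  refine PresentedGroup.ext fun i => ?_
  change φ (bdry i) = ψ (bdry i)
  fin_cases i
  · exact h0
  · exact h1
  · change φ (bdry 2) = ψ (bdry 2)
    rw [bdry_two_eq, map_inv, map_inv, map_mul, map_mul, h0, h1]

theorem closure_bdry : Subgroup.closure {bdry 0, bdry 1} = ⊤ := by
  rw [eq_top_iff, ← PresentedGroup.closure_range_of, Subgroup.closure_le]
  rintro _ ⟨i, rfl⟩
  change bdry i ∈ Subgroup.closure {bdry 0, bdry 1}
  have h0 : bdry 0 ∈ Subgroup.closure {bdry 0, bdry 1} := Subgroup.subset_closure (by simp)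
  have h1 : bdry 1 ∈ Subgroup.closure {bdry 0, bdry 1} := Subgroup.subset_closure (by simp)
  fin_cases i
  · exact h0
  · exact h1
  · change bdry 2 ∈ _
    rw [bdry_two_eq]
    exact inv_mem (mul_mem h1 h0)

/-- The automorphism `r ↦ s ↦ t ↦ r`. -/
def rotate : PantsGroup →* PantsGroup := pantsHom (bdry 1) (bdry 2)

theorem rotate_bdry (i : Fin 3) : rotate (bdry i) = bdry (i + 1) := by
  fin_cases i
  · exact pantsHom_bdry_zero _ _
  · exact pantsHom_bdry_one _ _
  · refine (pantsHom_bdry_two _ _).trans ?_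
    change _ = bdry 0
    rw [bdry_two_eq]; group

theorem rotate_surjective : Function.Surjective rotate := by
  rw [← MonoidHom.range_eq_top, eq_top_iff, ← closure_bdry, Subgroup.closure_le]
  rintro _ (rfl | rfl)
  · exact ⟨bdry 2, rotate_bdry 2⟩
  · exact ⟨bdry 0, rotate_bdry 0⟩

/-- Detected in the symmetric group on three letters: r and s go to two transpositions, t to a
3-cycle, and no two of these commute. -/
theorem not_commute_bdry {i j : Fin 3} (h : i ≠ j) : ¬ Commute (bdry i) (bdry j) := by
  intro hc
  have := hc.map (pantsHom (Equiv.swap (0 : Fin 3) 1) (Equiv.swap (1 : Fin 3) 2))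
  rw [Commute, SemiconjBy] at this
  fin_cases i <;> fin_cases j <;> simp at h <;> simp at this <;> revert this <;> decide

/-! ### Alternating words -/

/-- Alternating products of nontrivial powers of `s` and of `r` that begin and end with a power
of `s`. -/
inductive AltWord {G : Type} [Group G] (r s : G) : G → Prop
  | base (k : ℤ) (hk : k ≠ 0) : AltWord r s (s ^ k)
  | step (k l : ℤ) (w : G) (hk : k ≠ 0) (hl : l ≠ 0) (hw : AltWord r s w) :
      AltWord r s (s ^ k * (r ^ l * w))

/-- Only existence of the decomposition is claimed, so generation by r and s suffices and freeness
is not needed. -/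
theorem mem_zpowers_or_altWord {G : Type} [Group G] {r s : G}
    (h : Subgroup.closure {r, s} = ⊤) (y : G) :
    (∃ a : ℤ, y = r ^ a) ∨ ∃ (a b : ℤ) (w : G), AltWord r s w ∧ y = r ^ a * (w * r ^ b) := by
  have stepR : ∀ (e : ℤ) (y : G), ((∃ a : ℤ, y = r ^ a) ∨
      ∃ (a b : ℤ) (w : G), AltWord r s w ∧ y = r ^ a * (w * r ^ b)) →
      ((∃ a : ℤ, r ^ e * y = r ^ a) ∨
      ∃ (a b : ℤ) (w : G), AltWord r s w ∧ r ^ e * y = r ^ a * (w * r ^ b)) := by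
    rintro e y (⟨a, rfl⟩ | ⟨a, b, w, hw, rfl⟩)
    · exact .inl ⟨e + a, by rw [zpow_add]⟩
    · exact .inr ⟨e + a, b, w, hw, by rw [zpow_add, mul_assoc]⟩
  have stepS : ∀ (e : ℤ) (y : G), e ≠ 0 → ((∃ a : ℤ, y = r ^ a) ∨
      ∃ (a b : ℤ) (w : G), AltWord r s w ∧ y = r ^ a * (w * r ^ b)) →
      ((∃ a : ℤ, s ^ e * y = r ^ a) ∨
      ∃ (a b : ℤ) (w : G), AltWord r s w ∧ s ^ e * y = r ^ a * (w * r ^ b)) := by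
    rintro e y he (⟨a, rfl⟩ | ⟨a, b, w, hw, rfl⟩)
    · exact .inr ⟨0, a, _, .base e he, by simp⟩
    · by_cases ha : a = 0
      · subst ha
        -- With no power of r in front, s ^ e merges with the leading syllable; if the exponents
        -- cancel, that syllable disappears and the word shortens.
        rcases hw with ⟨k, hk⟩ | ⟨k, l, w, hk, hl, hw⟩
        · by_cases hek : e + k = 0
          · exact .inl ⟨b, by simp [← mul_assoc, ← zpow_add, hek]⟩
          · exact .inr ⟨0, b, _, .base _ hek, by simp [zpow_add, mul_assoc]⟩
        · by_cases hek : e + k = 0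
          · exact .inr ⟨l, b, w, hw, by simp [← mul_assoc, ← zpow_add, hek]⟩
          · exact .inr ⟨0, b, _, .step _ l w hek hl hw, by simp [zpow_add, mul_assoc]⟩
      · exact .inr ⟨0, b, _, .step e a w he ha hw, by simp [mul_assoc]⟩
  have hy : y ∈ Subgroup.closure {r, s} := h ▸ Subgroup.mem_top y
  induction hy using Subgroup.closure_induction_left with
  | one => exact .inl ⟨0, by simp⟩
  | mul_left x hx y _ ih =>
    rcases hx with rfl | rfl
    · simpa using stepR 1 y ih
    · simpa using stepS 1 y one_ne_zero ih
  | inv_mul_cancel x hx y _ ih =>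
    rcases hx with rfl | rfl
    · simpa using stepR (-1) y ih
    · simpa using stepS (-1) y (by norm_num) ih

/-! ### The normal form -/

section normalForm

variable {A : Type} [CommRing A]

/-- The matrix with rows `(0, -1)` and `(1, x)`. -/
def firstMat (x : A) : SL2 A := ⟨!![0, -1; 1, x], by simp [Matrix.det_fin_two_of]⟩

/-- The matrix with rows `(y, -v)` and `(v⁻¹, 0)`. -/
def secondMat (y : A) (v : Aˣ) : SL2 A :=
  ⟨!![y, -v; (v⁻¹ : Aˣ), 0], by simp [Matrix.det_fin_two_of]⟩

theorem SL2.inv_apply (g : SL2 A) : g⁻¹ 0 0 = g 1 1 ∧ g⁻¹ 0 1 = -g 0 1 ∧ g⁻¹ 1 0 = -g 1 0 ∧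
    g⁻¹ 1 1 = g 0 0 := by
  simp [Matrix.SpecialLinearGroup.SL2_inv_expl]

theorem coe_firstMat (x : A) : (firstMat x : Matrix (Fin 2) (Fin 2) A) = !![0, -1; 1, x] := rfl

theorem coe_secondMat (y : A) (v : Aˣ) :
    (secondMat y v : Matrix (Fin 2) (Fin 2) A) = !![y, -v; (v⁻¹ : Aˣ), 0] := rfl

/-- The representation of the pants group whose boundary traces are `x`, `y` and `-(v + v⁻¹)`. -/
def normalForm (x y : A) (v : Aˣ) : PantsGroup →* SL2 A := pantsHom (firstMat x) (secondMat y v)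

end normalForm

/-! ### Ping-pong across the imaginary half-line. -/

section pingPong

variable {x y : ℝ} {v : ℝˣ}

/-- The action is z ↦ -1/(z + x), and Re(z + x) > 1. The threshold -1, rather than 0, lets the
estimate be iterated. -/
theorem re_firstMat_smul (hx : 2 ≤ x) {z : UpperHalfPlane} (hz : -1 < z.re) :
    -1 < (firstMat x • z).re ∧ (firstMat x • z).re < 0 := by
  have hd := denom_pos (firstMat x) z
  rw [re_smul, lt_div_iff₀ hd, div_lt_iff₀ hd]
  have := z.im_pos
  simp only [coe_firstMat, Matrix.of_apply, Matrix.cons_val', Matrix.cons_val_zero,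
    Matrix.cons_val_one, Matrix.cons_val_fin_one]
  constructor <;> nlinarith

theorem re_firstMat_pow_smul (hx : 2 ≤ x) (k : ℕ) {z : UpperHalfPlane} (hz : -1 < z.re) :
    -1 < ((firstMat x) ^ (k + 1) • z).re ∧ ((firstMat x) ^ (k + 1) • z).re < 0 := by
  induction k with
  | zero => simpa using re_firstMat_smul hx hz
  | succ k ih => rw [pow_succ', mul_smul]; exact re_firstMat_smul hx ih.1

theorem re_firstMat_zpow_smul (hx : 2 ≤ x) {k : ℤ} (hk : k ≠ 0) {z : UpperHalfPlane}
    (hz : 0 ≤ z.re) : ((firstMat x) ^ k • z).re < 0 := by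
  obtain ⟨n, rfl | rfl⟩ := k.eq_nat_or_neg
  · obtain ⟨m, rfl⟩ := Nat.exists_eq_succ_of_ne_zero (n := n) (by simpa using hk)
    rw [zpow_natCast]
    exact (re_firstMat_pow_smul hx m (by linarith)).2
  · obtain ⟨m, rfl⟩ := Nat.exists_eq_succ_of_ne_zero (n := n) (by simpa using hk)
    -- Were the image under the negative power in Re ≥ 0, the positive power would bring it back to
    -- z with Re z < 0.
    by_contra! h
    have := (re_firstMat_pow_smul hx m
      (z := (firstMat x) ^ (-((m + 1 : ℕ) : ℤ)) • z) (by push_cast at h ⊢; linarith)).2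
    rw [zpow_neg, zpow_natCast, smul_inv_smul] at this
    linarith

/-- The inverse acts by z ↦ v/(y - z/v), whose denominator has real part greater than 1. -/
theorem re_secondMat_inv_smul (hy : 2 ≤ y) (hv : 0 < (v : ℝ)) {z : UpperHalfPlane}
    (hz : z.re < v) : 0 < ((secondMat y v)⁻¹ • z).re ∧ ((secondMat y v)⁻¹ • z).re < v := by
  have hd := denom_pos (secondMat y v)⁻¹ z
  rw [re_smul, lt_div_iff₀ hd, div_lt_iff₀ hd]
  have hi := z.im_pos
  have h1 : (v : ℝ)⁻¹ * v = 1 := inv_mul_cancel₀ hv.ne'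
  have h2 : 0 < (v : ℝ)⁻¹ := inv_pos.2 hv
  have h3 : (v : ℝ)⁻¹ * z.re < 1 := by nlinarith
  obtain ⟨e00, e01, e10, e11⟩ := SL2.inv_apply (secondMat y v)
  rw [e00, e01, e10, e11]
  simp only [coe_secondMat, Matrix.of_apply, Matrix.cons_val', Matrix.cons_val_zero,
    Matrix.cons_val_one, Matrix.cons_val_fin_one, Units.val_inv_eq_inv_val]
  set u := (v : ℝ)⁻¹
  have h4 : (v : ℝ) * u = 1 := by linarith
  have h5 : v * (y - u * z.re) = v * y - z.re := by linear_combination (-z.re) * h4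
  have h6 : 0 < (u * z.im) ^ 2 := by positivity
  constructor
  · nlinarith
  · have : 1 < y - u * z.re := by linarith
    nlinarith [mul_pos hv (sub_pos.2 this), mul_pos hv h6,
      mul_pos (mul_pos hv (sub_pos.2 this)) (sub_pos.2 this)]

theorem re_secondMat_inv_pow_smul (hy : 2 ≤ y) (hv : 0 < (v : ℝ)) (k : ℕ) {z : UpperHalfPlane}
    (hz : z.re < v) : 0 < ((secondMat y v)⁻¹ ^ (k + 1) • z).re ∧
      ((secondMat y v)⁻¹ ^ (k + 1) • z).re < v := by
  induction k with
  | zero => simpa using re_secondMat_inv_smul hy hv hz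
  | succ k ih => rw [pow_succ', mul_smul]; exact re_secondMat_inv_smul hy hv ih.2

theorem re_secondMat_zpow_smul (hy : 2 ≤ y) (hv : 0 < (v : ℝ)) {k : ℤ} (hk : k ≠ 0)
    {z : UpperHalfPlane} (hz : z.re ≤ 0) : 0 < ((secondMat y v) ^ k • z).re := by
  obtain ⟨n, rfl | rfl⟩ := k.eq_nat_or_neg
  · obtain ⟨m, rfl⟩ := Nat.exists_eq_succ_of_ne_zero (n := n) (by simpa using hk)
    by_contra! h
    have := (re_secondMat_inv_pow_smul hy hv m
      (z := (secondMat y v) ^ ((m + 1 : ℕ) : ℤ) • z) (by push_cast at h ⊢; linarith)).1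
    rw [zpow_natCast, inv_pow, inv_smul_smul] at this
    linarith
  · obtain ⟨m, rfl⟩ := Nat.exists_eq_succ_of_ne_zero (n := n) (by simpa using hk)
    rw [zpow_neg, zpow_natCast, ← inv_pow]
    exact (re_secondMat_inv_pow_smul hy hv m (by linarith)).1

theorem re_normalForm_altWord_smul (hx : 2 ≤ x) (hy : 2 ≤ y) (hv : 0 < (v : ℝ)) {w : PantsGroup}
    (hw : AltWord (bdry 0) (bdry 1) w) {z : UpperHalfPlane} (hz : z.re ≤ 0) :
    0 < (normalForm x y v w • z).re := by
  induction hw with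
  | base k hk =>
    rw [map_zpow, normalForm, pantsHom_bdry_one]
    exact re_secondMat_zpow_smul hy hv hk hz
  | step k l w hk hl hw ih =>
    rw [map_mul, map_mul, map_zpow, map_zpow, mul_smul, mul_smul]
    have h1 : normalForm x y v (bdry 1) = secondMat y v := pantsHom_bdry_one _ _
    have h0 : normalForm x y v (bdry 0) = firstMat x := pantsHom_bdry_zero _ _
    rw [h1, h0]
    exact re_secondMat_zpow_smul hy hv hk (re_firstMat_zpow_smul hx hl ih.le).le

/-- A nontrivial element has a conjugate by `1`, `r` or `r²` that exchanges the sides of the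
imaginary half-line. -/
theorem exists_conj_re_neg (hx : 2 ≤ x) (hy : 2 ≤ y) (hv : 0 < (v : ℝ)) {g : PantsGroup}
    (hg : g ≠ 1) : ∃ j : Fin 3, ∀ z : UpperHalfPlane, 0 ≤ z.re →
      (normalForm x y v (bdry 0 ^ (j : ℕ) * g * (bdry 0 ^ (j : ℕ))⁻¹) • z).re < 0 := by
  have h0 : normalForm x y v (bdry 0) = firstMat x := pantsHom_bdry_zero _ _
  rcases mem_zpowers_or_altWord closure_bdry g with ⟨a, rfl⟩ | ⟨a, b, w, hw, rfl⟩
  · refine ⟨0, fun z hz => ?_⟩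
    have ha : a ≠ 0 := by
      rintro rfl
      exact hg (zpow_zero _)
    simpa [h0] using re_firstMat_zpow_smul hx ha hz
  -- Conjugation by r ^ j turns the outer exponents into a + j and b - j. Only j = -a and j = b are
  -- bad, so one of three values works.
  · obtain ⟨j, ha, hb⟩ : ∃ j : Fin 3, ((j : ℕ) : ℤ) + a ≠ 0 ∧ b - ((j : ℕ) : ℤ) ≠ 0 := by
      by_contra! h
      have h0 := h 0
      have h1 := h 1
      have h2 := h 2
      simp at h0 h1 h2
      omega
    refine ⟨j, fun z hz => ?_⟩
    have : bdry 0 ^ (j : ℕ) * (bdry 0 ^ a * (w * bdry 0 ^ b)) * (bdry 0 ^ (j : ℕ))⁻¹ =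
        bdry 0 ^ (((j : ℕ) : ℤ) + a) * (w * bdry 0 ^ (b - ((j : ℕ) : ℤ))) := by
      simp [zpow_add, zpow_sub, mul_assoc]
    rw [this, map_mul, map_mul, map_zpow, map_zpow, h0, mul_smul, mul_smul]
    exact re_firstMat_zpow_smul hx ha
      (re_normalForm_altWord_smul hx hy hv hw (re_firstMat_zpow_smul hx hb hz).le).le

end pingPong

/-! ### The normal form is the holonomy of a pair of pants -/

/-- A matrix of positive determinant, rescaled to determinant one. -/
theorem exists_scaled_conj (Q : Matrix (Fin 2) (Fin 2) ℝ) (hQ : 0 < Q.det) :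
    ∃ (P : SL2 ℝ) (k : ℝ), 0 < k ∧ P.1 = k • Q ∧
      ∀ M N : SL2 ℝ, M.1 * Q = Q * N.1 → M = P * N * P⁻¹ := by
  have hk : 0 < (√Q.det)⁻¹ := inv_pos.2 (Real.sqrt_pos.2 hQ)
  obtain ⟨P, hP⟩ : ∃ P : SL2 ℝ, P.1 = (√Q.det)⁻¹ • Q :=
    ⟨⟨(√Q.det)⁻¹ • Q, by rw [Matrix.det_smul, Fintype.card_fin, inv_pow, Real.sq_sqrt hQ.le,
      inv_mul_cancel₀ hQ.ne']⟩, rfl⟩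
  refine ⟨P, _, hk, hP, fun M N h => ?_⟩
  rw [eq_mul_inv_iff_mul_eq]
  refine Subtype.ext ?_
  rw [Matrix.SpecialLinearGroup.coe_mul, Matrix.SpecialLinearGroup.coe_mul, hP]
  simp only [Matrix.mul_smul, Matrix.smul_mul, h]

/-- The unit `e^a` of `ℝ`. -/
def expUnit (a : ℝ) : ℝˣ :=
  ⟨Real.exp a, Real.exp (-a), by rw [← Real.exp_add]; simp, by rw [← Real.exp_add]; simp⟩

theorem val_expUnit (a : ℝ) : (expUnit a : ℝ) = Real.exp a := rfl

theorem val_inv_expUnit (a : ℝ) : ((expUnit a)⁻¹ : ℝˣ) = Real.exp (-a) := rfl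

/-- The representation with boundary lengths `l`, `m`, `n`. -/
def normalRep (l m n : ℝ) : PantsGroup →* PSL2 ℝ :=
  (QuotientGroup.mk' _).comp
    (normalForm (2 * Real.cosh (l / 2)) (2 * Real.cosh (m / 2)) (expUnit (n / 2)))

theorem normalRep_apply (l m n : ℝ) (y : PantsGroup) : normalRep l m n y =
    toPSL2 (normalForm (2 * Real.cosh (l / 2)) (2 * Real.cosh (m / 2)) (expUnit (n / 2)) y) := rfl

theorem two_le_two_cosh (a : ℝ) : 2 ≤ 2 * Real.cosh a := by linarith [Real.one_le_cosh a]

theorem normalRep_injective (l m n : ℝ) : Function.Injective (normalRep l m n) := by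
  rw [injective_iff_map_eq_one]
  intro g hg
  by_contra h
  obtain ⟨j, hj⟩ := exists_conj_re_neg (two_le_two_cosh (l / 2)) (two_le_two_cosh (m / 2))
    (v := expUnit (n / 2)) (Real.exp_pos _) h
  have h1 : normalRep l m n (bdry 0 ^ (j : ℕ) * g * (bdry 0 ^ (j : ℕ))⁻¹) = toPSL2 1 := by
    rw [map_mul, map_mul, hg, map_inv, mul_one, mul_inv_cancel]; rfl
  have h2 := hj UpperHalfPlane.I (by simp)
  rw [smul_eq_of_toPSL2_eq h1, one_smul] at h2
  simp at h2

theorem normalRep_discrete (l m n : ℝ) : DiscreteTopology (normalRep l m n).range := by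
  -- The identity keeps z₀ in Re > 0, while a nontrivial element has one of three conjugates sending
  -- it to Re < 0; three open conditions therefore isolate the identity.
  let z₀ : UpperHalfPlane := ⟨⟨1, 1⟩, one_pos⟩
  let V : Set (PSL2 ℝ) := (toPSL2 : SL2 ℝ → PSL2 ℝ) '' {M | 0 < (M • z₀).re}
  have hV : IsOpen V := by
    refine QuotientGroup.isOpenMap_coe _ ?_
    exact isOpen_lt continuous_const
      (UpperHalfPlane.continuous_re.comp (continuous_id.smul continuous_const))
  let c : Fin 3 → PSL2 ℝ := fun j => normalRep l m n (bdry 0 ^ (j : ℕ))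
  let W : Set (PSL2 ℝ) := ⋂ j, (fun A => c j * A * (c j)⁻¹) ⁻¹' V
  have hW : IsOpen W := isOpen_iInter_of_finite fun j => hV.preimage (by fun_prop)
  refine discreteTopology_of_isOpen_singleton_one ?_
  convert hW.preimage continuous_subtype_val
  ext ⟨A, g, rfl⟩
  simp only [Set.mem_singleton_iff, Set.mem_preimage, W, Set.mem_iInter]
  constructor
  · intro h j
    have : normalRep l m n g = 1 := congrArg Subtype.val h
    rw [this, mul_one, mul_inv_cancel]
    exact ⟨1, by rw [Set.mem_ofPred_eq, one_smul]; exact one_pos, rfl⟩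
  · intro h
    by_contra hg
    have hg' : g ≠ 1 := by
      rintro rfl
      exact hg (Subtype.ext (map_one _))
    obtain ⟨j, hj⟩ := exists_conj_re_neg (two_le_two_cosh (l / 2)) (two_le_two_cosh (m / 2))
      (v := expUnit (n / 2)) (Real.exp_pos _) hg'
    obtain ⟨M, hM, hMj⟩ := h j
    have h1 : toPSL2 M = normalRep l m n (bdry 0 ^ (j : ℕ) * g * (bdry 0 ^ (j : ℕ))⁻¹) := by
      rw [hMj, map_mul, map_mul, map_inv]
    rw [normalRep_apply] at h1
    rw [Set.mem_ofPred_eq, smul_eq_of_toPSL2_eq h1] at hM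
    have := hj z₀ (zero_le_one (α := ℝ))
    linarith

open scoped Pointwise in
theorem re_hypMat_zpow_smul_pos_iff (l : ℝ) (k : ℤ) (z : UpperHalfPlane) :
    0 < ((hypMat l) ^ k • z).re ↔ 0 < z.re := by
  have h : hypMat l ∈ MulAction.stabilizer (SL2 ℝ) {z : UpperHalfPlane | 0 < z.re} := by
    rw [MulAction.mem_stabilizer_set]
    intro z
    rw [Set.mem_ofPred_eq, Set.mem_ofPred_eq, re_smul_pos_iff]
    simp [hypMat, ← Real.exp_add]
  exact (MulAction.mem_stabilizer_set.1 (zpow_mem h k)) z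

theorem surfaceOnLeft_bdry_zero {l : ℝ} (hl : 0 ≤ l) (m n : ℝ) :
    SurfaceOnLeft (normalRep l m n) (bdry 0) := by
  have h0 : normalRep l m n (bdry 0) = toPSL2 (firstMat (2 * Real.cosh (l / 2))) := by
    rw [normalRep_apply, normalForm, pantsHom_bdry_zero]
  rcases hl.eq_or_lt with rfl | hl
  -- The first column is the fixed vector of the trace-2 matrix; the second completes it to a basis
  -- in which the matrix is `parMat`.
  · obtain ⟨P, -, -, -, hP⟩ := exists_scaled_conj !![1, 0; -1, 1] (by simp)
    refine .inr ⟨P, ?_⟩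
    rw [h0]
    congr 1
    refine hP _ _ ?_
    ext i j
    fin_cases i <;> fin_cases j <;> simp [firstMat, parMat, Matrix.mul_apply, Fin.sum_univ_two] <;>
      norm_num
  · set e := Real.exp (l / 2) with he
    have he1 : 1 < e := Real.one_lt_exp_iff.2 (by linarith)
    have hei : Real.exp (-(l / 2)) = e⁻¹ := Real.exp_neg _
    have hx : 2 * Real.cosh (l / 2) = e + e⁻¹ := by rw [Real.cosh_eq, hei]; ring
    -- The columns are eigenvectors for e and e⁻¹, giving the attracting point -1/e and the
    -- repelling point -e.
    obtain ⟨P, k, hk, hP, hconj⟩ := exists_scaled_conj !![-1, -e; e, 1] (by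
      rw [Matrix.det_fin_two_of]; nlinarith)
    have hR : firstMat (2 * Real.cosh (l / 2)) = P * hypMat l * P⁻¹ := by
      refine hconj _ _ ?_
      rw [hx]
      ext i j
      fin_cases i <;> fin_cases j <;>
        simp [firstMat, hypMat, hei, ← he, Matrix.mul_apply, Fin.sum_univ_two] <;> field_simp <;>
          ring
    have hPe : P 0 0 = -k ∧ P 0 1 = -(k * e) ∧ P 1 0 = k * e ∧ P 1 1 = k := by
      simp [hP]
    -- The half-plane to the right of the axis is the half-disc over the interval (-e, -1/e).
    have hU : ∀ z : UpperHalfPlane, 0 < (P⁻¹ • z).re → z.re < 0 := by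
      intro z hz
      have h1 := (re_smul P (P⁻¹ • z))
      rw [smul_inv_smul] at h1
      rw [h1]
      refine div_neg_of_neg_of_pos ?_ (denom_pos _ _)
      obtain ⟨e1, e2, e3, e4⟩ := hPe
      rw [e1, e2, e3, e4]
      have hi := (P⁻¹ • z).im_pos
      set w := P⁻¹ • z
      have : -k * (k * e) * (w.re ^ 2 + w.im ^ 2) + (-k * k + -(k * e) * (k * e)) * w.re +
        -(k * e) * k = -(k ^ 2 * (e * (w.re ^ 2 + w.im ^ 2) + (1 + e ^ 2) * w.re + e)) := by ring
      rw [this, neg_lt_zero]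
      positivity
    have hinv : ∀ (b : ℤ) (z : UpperHalfPlane),
        0 < (P⁻¹ • (firstMat (2 * Real.cosh (l / 2)) ^ b • z)).re ↔ 0 < (P⁻¹ • z).re := by
      intro b z
      rw [hR, conj_zpow, mul_smul, mul_smul, inv_smul_smul, re_hypMat_zpow_smul_pos_iff]
    refine .inl ⟨P, l, hl, by rw [h0, hR], fun y hy M hM z hz hMz => ?_⟩
    rw [smul_eq_of_toPSL2_eq (hM.trans (normalRep_apply l m n y))] at hMz
    -- The outer powers of r preserve the half-disc, and the alternating word between them throws it
    -- into Re > 0.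
    rcases mem_zpowers_or_altWord closure_bdry y with ⟨a, rfl⟩ | ⟨a, b, w, hw, rfl⟩
    · exact hy ⟨a, rfl⟩
    · have h0' : normalForm (2 * Real.cosh (l / 2)) (2 * Real.cosh (m / 2)) (expUnit (n / 2))
        (bdry 0) = firstMat (2 * Real.cosh (l / 2)) := pantsHom_bdry_zero _ _
      rw [map_mul, map_mul, map_zpow, map_zpow, h0', mul_smul, mul_smul, hinv] at hMz
      have h1 := hU _ hMz
      have h2 := hU _ ((hinv b z).2 hz)
      have h3 := re_normalForm_altWord_smul (two_le_two_cosh (l / 2)) (two_le_two_cosh (m / 2))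
        (v := expUnit (n / 2)) (Real.exp_pos _) hw h2.le
      linarith

/-! ### Conjugation and the cyclic symmetry of the boundary curves. -/

theorem SurfaceOnLeft.conj {G : Type} [Group G] {ρ σ : G →* PSL2 ℝ} {x : G}
    (h : SurfaceOnLeft ρ x) (Q : SL2 ℝ) (hσ : ∀ y, σ y = toPSL2 Q * ρ y * (toPSL2 Q)⁻¹) :
    SurfaceOnLeft σ x := by
  rcases h with ⟨P, l, hl, hx, hU⟩ | ⟨P, hx⟩
  · refine .inl ⟨Q * P, l, hl, ?_, fun y hy M hM z hz hz' => ?_⟩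
    · rw [hσ, hx]
      change toPSL2 (Q * (P * hypMat l * P⁻¹) * Q⁻¹) = _
      congr 1
      group
    · refine hU y hy (Q⁻¹ * M * Q) ?_ (Q⁻¹ • z) ?_ ?_
      · change (toPSL2 Q)⁻¹ * toPSL2 M * toPSL2 Q = _
        rw [hM, hσ]
        group
      · rwa [mul_inv_rev, mul_smul] at hz
      · rw [mul_inv_rev, mul_smul] at hz'
        rwa [mul_smul, mul_smul, smul_inv_smul]
  · refine .inr ⟨Q * P, ?_⟩
    rw [hσ, hx]
    change toPSL2 (Q * (P * parMat * P⁻¹) * Q⁻¹) = _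
    congr 1
    group

theorem SurfaceOnLeft.of_comp {G H : Type} [Group G] [Group H] {ρ : H →* PSL2 ℝ} {f : G →* H}
    (hf : Function.Surjective f) {x : G} (h : SurfaceOnLeft (ρ.comp f) x) :
    SurfaceOnLeft ρ (f x) := by
  rcases h with ⟨P, l, hl, hx, hU⟩ | h
  · refine .inl ⟨P, l, hl, hx, fun y hy M hM z => ?_⟩
    obtain ⟨y, rfl⟩ := hf y
    refine hU y (fun hy' => hy ?_) M hM z
    obtain ⟨k, rfl⟩ := hy'
    exact ⟨k, (map_zpow f x k).symm⟩
  · exact .inr h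

theorem normalRep_rotate (l m n : ℝ) : ∃ Q : SL2 ℝ, ∀ y,
    normalRep l m n (rotate y) = toPSL2 Q * normalRep m n l y * (toPSL2 Q)⁻¹ := by
  set e := Real.exp (l / 2) with he
  set v := Real.exp (n / 2) with hv
  set c := 2 * Real.cosh (m / 2) with hc
  have he0 : 0 < e := Real.exp_pos _
  have hv0 : 0 < v := Real.exp_pos _
  have hc0 : 0 < c := by linarith [two_le_two_cosh (m / 2)]
  have hei : Real.exp (-(l / 2)) = e⁻¹ := Real.exp_neg _
  have hvi : Real.exp (-(n / 2)) = v⁻¹ := Real.exp_neg _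
  have hx : 2 * Real.cosh (l / 2) = e + e⁻¹ := by rw [Real.cosh_eq, hei]; ring
  have hy : 2 * Real.cosh (n / 2) = v + v⁻¹ := by rw [Real.cosh_eq, hvi]; ring
  -- After rotation r plays the role of t: the first column is the eigenvector of r for e⁻¹, and the
  -- second is its image under s.
  obtain ⟨Q, k, -, -, hQ⟩ := exists_scaled_conj !![-e, -(c * e + v); 1, -(e * v⁻¹)] (by
    rw [Matrix.det_fin_two_of]
    have : -e * -(e * v⁻¹) - -(c * e + v) * 1 = e * e * v⁻¹ + c * e + v := by ring
    rw [this]; positivity)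
  refine ⟨Q, fun y => ?_⟩
  have h1 : secondMat c (expUnit (n / 2)) = Q * firstMat c * Q⁻¹ := by
    refine hQ _ _ ?_
    ext i j
    fin_cases i <;> fin_cases j <;>
      simp [coe_firstMat, coe_secondMat, val_expUnit, val_inv_expUnit, ← hv, hvi, Matrix.mul_apply,
        Fin.sum_univ_two, -Units.val_inv_eq_inv_val] <;> field_simp <;> ring
  -- The sign selects the lift of t with positive trace, as the normal form for the rotated triple
  -- requires.
  have h2 : -(secondMat c (expUnit (n / 2)) * firstMat (e + e⁻¹))⁻¹ =
      Q * secondMat (v + v⁻¹) (expUnit (l / 2)) * Q⁻¹ := by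
    refine hQ _ _ ?_
    ext i j
    fin_cases i <;> fin_cases j <;>
      simp [coe_firstMat, coe_secondMat, val_expUnit, val_inv_expUnit, ← hv, ← he, hei, hvi,
        Matrix.mul_apply, Fin.sum_univ_two, -Units.val_inv_eq_inv_val,
        -mul_inv_rev, Matrix.adjugate_fin_two] <;>
      field_simp <;> ring
  have h3 : (normalRep l m n).comp rotate =
      (MulAut.conj (toPSL2 Q)).toMonoidHom.comp (normalRep m n l) := by
    refine pantsGroup_hom_ext ?_ ?_
    · simp only [MonoidHom.comp_apply, rotate_bdry, normalRep_apply, normalForm]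
      change toPSL2 (pantsHom _ _ (bdry 1)) = toPSL2 Q * toPSL2 _ * (toPSL2 Q)⁻¹
      rw [pantsHom_bdry_one, pantsHom_bdry_zero, ← hc, h1]
      rfl
    · simp only [MonoidHom.comp_apply, rotate_bdry, normalRep_apply, normalForm]
      change toPSL2 (pantsHom _ _ (bdry 2)) = toPSL2 Q * toPSL2 _ * (toPSL2 Q)⁻¹
      rw [pantsHom_bdry_one, pantsHom_bdry_two, hx, hy, ← hc]
      change _ = toPSL2 (Q * _ * Q⁻¹)
      rw [← h2, toPSL2_eq_iff]
      exact .inr rfl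
  exact DFunLike.congr_fun h3 y

theorem isPantsHolonomy_normalRep {l m n : ℝ} (hl : 0 ≤ l) (hm : 0 ≤ m) (hn : 0 ≤ n) :
    IsPantsHolonomy (normalRep l m n) := by
  refine ⟨normalRep_injective l m n, normalRep_discrete l m n, fun i => ?_⟩
  have step : ∀ (l m n : ℝ) (i : Fin 3), SurfaceOnLeft (normalRep m n l) (bdry i) →
      SurfaceOnLeft (normalRep l m n) (bdry (i + 1)) := by
    intro l m n i h
    obtain ⟨Q, hQ⟩ := normalRep_rotate l m n
    rw [← rotate_bdry]
    exact .of_comp rotate_surjective (h.conj (σ := (normalRep l m n).comp rotate) Q hQ)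
  fin_cases i
  · exact surfaceOnLeft_bdry_zero hl m n
  · exact step l m n 0 (surfaceOnLeft_bdry_zero hm n l)
  · exact step l m n 1 (step m n l 0 (surfaceOnLeft_bdry_zero hn l m))

open Matrix

/-! ### Uniqueness of the holonomy with given boundary lengths -/

/-- The signed area of the parallelogram spanned by two vectors of the plane. -/
def area (e f : Fin 2 → ℝ) : ℝ := e 0 * f 1 - e 1 * f 0

theorem SL2.mulVec_apply (M : SL2 ℝ) (e : Fin 2 → ℝ) :
    (M.1 *ᵥ e) 0 = M 0 0 * e 0 + M 0 1 * e 1 ∧ (M.1 *ᵥ e) 1 = M 1 0 * e 0 + M 1 1 * e 1 := by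
  simp [Matrix.mulVec, dotProduct, Fin.sum_univ_two]

theorem SL2.det_eq (M : SL2 ℝ) : M 0 0 * M 1 1 - M 0 1 * M 1 0 = 1 := by
  have := M.det_coe
  rwa [Matrix.det_fin_two] at this

theorem area_mulVec (M : SL2 ℝ) (e f : Fin 2 → ℝ) : area (M.1 *ᵥ e) (M.1 *ᵥ f) = area e f := by
  obtain ⟨h1, h2⟩ := SL2.mulVec_apply M e
  obtain ⟨h3, h4⟩ := SL2.mulVec_apply M f
  rw [area, area, h1, h2, h3, h4]
  linear_combination (e 0 * f 1 - e 1 * f 0) * M.det_eq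

theorem SL2.mulVec_mulVec (M : SL2 ℝ) (e : Fin 2 → ℝ) :
    M.1 *ᵥ (M.1 *ᵥ e) = M.1.trace • (M.1 *ᵥ e) - e := by
  obtain ⟨h1, h2⟩ := SL2.mulVec_apply M e
  obtain ⟨h3, h4⟩ := SL2.mulVec_apply M (M.1 *ᵥ e)
  have hd := M.det_eq
  ext i
  fin_cases i
  · simp only [Fin.zero_eta, Pi.sub_apply, Pi.smul_apply, smul_eq_mul, Matrix.trace_fin_two]
    rw [h3, h1, h2]
    linear_combination (-e 0) * hd
  · simp only [Fin.mk_one, Pi.sub_apply, Pi.smul_apply, smul_eq_mul, Matrix.trace_fin_two]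
    rw [h4, h1, h2]
    linear_combination (-e 1) * hd

theorem SL2.inv_mulVec_mulVec (M : SL2 ℝ) (e : Fin 2 → ℝ) : (M⁻¹).1 *ᵥ (M.1 *ᵥ e) = e := by
  rw [Matrix.mulVec_mulVec, ← Matrix.SpecialLinearGroup.coe_mul, inv_mul_cancel]
  simp

theorem SL2.mulVec_inv_mulVec (M : SL2 ℝ) (e : Fin 2 → ℝ) : M.1 *ᵥ ((M⁻¹).1 *ᵥ e) = e := by
  rw [Matrix.mulVec_mulVec, ← Matrix.SpecialLinearGroup.coe_mul, mul_inv_cancel]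
  simp

theorem SL2.mul_mulVec (M N : SL2 ℝ) (e : Fin 2 → ℝ) : (M * N).1 *ᵥ e = M.1 *ᵥ (N.1 *ᵥ e) := by
  rw [Matrix.mulVec_mulVec, Matrix.SpecialLinearGroup.coe_mul]

theorem trace_conj (P K : SL2 ℝ) : (P * K * P⁻¹).1.trace = K.1.trace := by
  rw [Matrix.SpecialLinearGroup.coe_mul, Matrix.trace_mul_comm,
    ← Matrix.SpecialLinearGroup.coe_mul, ← mul_assoc, inv_mul_cancel, one_mul]

theorem trace_hypMat (l : ℝ) : (hypMat l).1.trace = 2 * Real.cosh (l / 2) := by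
  rw [Matrix.trace_fin_two, Real.cosh_eq]
  simp [hypMat]
  ring

theorem trace_parMat : parMat.1.trace = 2 := by
  rw [Matrix.trace_fin_two]
  simp [parMat]
  norm_num

theorem hypLength_toPSL2 (M : SL2 ℝ) : hypLength (toPSL2 M) = 2 * Real.arcosh (|M.1.trace| / 2) :=
  rfl

theorem hypLength_of_abs_trace {M : SL2 ℝ} {l : ℝ} (hl : 0 ≤ l)
    (h : |M.1.trace| = 2 * Real.cosh (l / 2)) : hypLength (toPSL2 M) = l := by
  rw [hypLength_toPSL2, h, mul_div_cancel_left₀ _ two_ne_zero, Real.arcosh_cosh (by linarith)]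
  ring

theorem hypLength_conj_hypMat (P : SL2 ℝ) {l : ℝ} (hl : 0 ≤ l) :
    hypLength (toPSL2 (P * hypMat l * P⁻¹)) = l := by
  refine hypLength_of_abs_trace hl ?_
  rw [trace_conj, trace_hypMat, abs_of_pos (by linarith [two_le_two_cosh (l / 2)])]

theorem hypLength_conj_parMat (P : SL2 ℝ) : hypLength (toPSL2 (P * parMat * P⁻¹)) = 0 := by
  refine hypLength_of_abs_trace le_rfl ?_
  rw [trace_conj, trace_parMat]
  simp

/-- Choosing the lift of positive trace removes the sign ambiguity of PSL(2, ℝ). -/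
theorem SurfaceOnLeft.exists_lift {G : Type} [Group G] {ρ : G →* PSL2 ℝ} {x : G}
    (h : SurfaceOnLeft ρ x) : 0 ≤ hypLength (ρ x) ∧
      ∃ X : SL2 ℝ, ρ x = toPSL2 X ∧ X.1.trace = 2 * Real.cosh (hypLength (ρ x) / 2) := by
  rcases h with ⟨P, l, hl, hx, -⟩ | ⟨P, hx⟩
  · rw [hx, hypLength_conj_hypMat P hl.le]
    exact ⟨hl.le, _, rfl, by rw [trace_conj, trace_hypMat]⟩
  · rw [hx, hypLength_conj_parMat P]
    exact ⟨le_rfl, _, rfl, by rw [trace_conj, trace_parMat]; simp⟩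

theorem eq_of_toPSL2_eq_of_trace_pos {M N : SL2 ℝ} (h : toPSL2 M = toPSL2 N)
    (hM : 0 < M.1.trace) (hN : 0 < N.1.trace) : M = N := by
  rcases (toPSL2_eq_iff M N).1 h with h | rfl
  · exact h.symm
  · rw [Matrix.SpecialLinearGroup.coe_neg, Matrix.trace_neg] at hN
    linarith

theorem entries_of_disjoint_conj {P M : SL2 ℝ}
    (h : ∀ z : UpperHalfPlane, 0 < (P⁻¹ • z).re → ¬ 0 < (P⁻¹ • (M • z)).re) :
    (P⁻¹ * M * P) 0 0 * (P⁻¹ * M * P) 1 0 ≤ 0 ∧ (P⁻¹ * M * P) 0 1 * (P⁻¹ * M * P) 1 1 ≤ 0 ∧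
      (P⁻¹ * M * P) 0 0 * (P⁻¹ * M * P) 1 1 + (P⁻¹ * M * P) 0 1 * (P⁻¹ * M * P) 1 0 ≤ 0 := by
  refine entries_of_disjoint _ fun z hz => ?_
  rw [mul_smul, mul_smul]
  exact h (P • z) (by rwa [inv_smul_smul])

/-- The eigenvectors of a matrix mapping the quadrant `Re z > 0` off itself lie outside the
corresponding boundary interval. -/
theorem mul_neg_of_eigenvector {M : SL2 ℝ} {f : Fin 2 → ℝ} {τ : ℝ} (h1 : M 0 0 * M 1 0 ≤ 0)
    (h2 : M 0 1 * M 1 1 ≤ 0) (h3 : M 0 0 * M 1 1 + M 0 1 * M 1 0 ≤ 0) (hτ : 0 < τ)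
    (hM : M.1 *ᵥ f = τ • f) (hf : f ≠ 0) : f 0 * f 1 < 0 := by
  obtain ⟨e0, e1⟩ := SL2.mulVec_apply M f
  have hd := M.det_eq
  rw [hM, Pi.smul_apply, smul_eq_mul] at e0 e1
  have hprod : M 0 0 * M 1 0 * f 0 ^ 2 + (M 0 0 * M 1 1 + M 0 1 * M 1 0) * (f 0 * f 1) +
      M 0 1 * M 1 1 * f 1 ^ 2 = τ ^ 2 * (f 0 * f 1) := by
    linear_combination (-(M 1 0 * f 0 + M 1 1 * f 1)) * e0 - τ * f 0 * e1
  by_contra! hneg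
  rcases hneg.eq_or_lt with h0 | hpos
  · rcases mul_eq_zero.1 h0.symm with h0 | h0
    · have hf1 : f 1 ≠ 0 := fun h => hf (by ext i; fin_cases i <;> assumption)
      have hb : M 0 1 = 0 := by
        rw [h0] at e0
        simpa [hf1] using e0.symm
      rw [hb] at hd h3
      linarith
    · have hf0 : f 0 ≠ 0 := fun h => hf (by ext i; fin_cases i <;> assumption)
      have hc : M 1 0 = 0 := by
        rw [h0] at e1
        simpa [hf0] using e1.symm
      rw [hc] at hd h3
      linarith
  · have : 0 < τ ^ 2 * (f 0 * f 1) := by positivity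
    have a1 := mul_nonneg (neg_nonneg.2 h1) (sq_nonneg (f 0))
    have a2 := mul_nonneg (neg_nonneg.2 h3) hpos.le
    have a3 := mul_nonneg (neg_nonneg.2 h2) (sq_nonneg (f 1))
    linarith

/-- A boundary curve `t` has a fixed point (a direction `e`) about which every other boundary curve
not commuting with `t` turns in the positive sense. -/
theorem SurfaceOnLeft.exists_eigenvector {G : Type} [Group G] {ρ : G →* PSL2 ℝ}
    (hρ : Function.Injective ρ) {t : G} (ht : SurfaceOnLeft ρ t) :
    ∃ (T : SL2 ℝ) (e : Fin 2 → ℝ), ρ t = toPSL2 T ∧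
      T.1 *ᵥ e = Real.exp (-(hypLength (ρ t) / 2)) • e ∧
      ∀ (x : G) (X : SL2 ℝ), SurfaceOnLeft ρ x → ¬ Commute x t → ρ x = toPSL2 X →
        0 < X.1.trace → 0 < area e (X.1 *ᵥ e) := by
  obtain ⟨T, e, hT, hTe, he, hfix⟩ : ∃ (T : SL2 ℝ) (e : Fin 2 → ℝ), ρ t = toPSL2 T ∧
      T.1 *ᵥ e = Real.exp (-(hypLength (ρ t) / 2)) • e ∧ e ≠ 0 ∧
      ∀ (x : G) (X : SL2 ℝ), ¬ Commute x t → ρ x = toPSL2 X → X.1.trace = 2 →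
        X.1 *ᵥ e ≠ e := by
    rcases ht with ⟨Q, n, hn, hx, hU⟩ | ⟨Q, hx⟩
    · refine ⟨_, Q.1 *ᵥ ![0, 1], hx, ?_, ?_, ?_⟩
      · rw [hx, hypLength_conj_hypMat Q hn.le, SL2.mul_mulVec, SL2.mul_mulVec,
          SL2.inv_mulVec_mulVec, ← Matrix.mulVec_smul]
        congr 1
        ext i; fin_cases i <;> simp [hypMat]
      · intro h
        have := SL2.inv_mulVec_mulVec Q ![0, 1]
        rw [h, Matrix.mulVec_zero] at this
        simpa using congrFun this 1
      · intro x X hxt hX htr hXe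
        have hxt' : x ∉ Subgroup.zpowers t := by
          rintro ⟨k, rfl⟩
          exact hxt ((Commute.refl t).zpow_left k)
        -- X moves the half-plane of t off itself, so its eigenvectors have coordinates of strictly
        -- opposite signs there; (0, 1) does not.
        obtain ⟨h1, h2, h3⟩ := entries_of_disjoint_conj (hU x hxt' X hX.symm)
        have h4 := mul_neg_of_eigenvector (f := ![0, 1]) (τ := 1) h1 h2 h3 one_pos (by
          rw [SL2.mul_mulVec, SL2.mul_mulVec, hXe, SL2.inv_mulVec_mulVec, one_smul])
          (fun h => by simpa using congrFun h 1)
        simp at h4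
    · refine ⟨_, Q.1 *ᵥ ![1, 0], hx, ?_, ?_, ?_⟩
      · rw [hx, hypLength_conj_parMat Q, SL2.mul_mulVec, SL2.mul_mulVec,
          SL2.inv_mulVec_mulVec, ← Matrix.mulVec_smul]
        congr 1
        ext i; fin_cases i <;> simp [parMat]
      · intro h
        have := SL2.inv_mulVec_mulVec Q ![1, 0]
        rw [h, Matrix.mulVec_zero] at this
        simpa using congrFun this 0
      · intro x X hxt hX htr hXe
        -- A unipotent X fixing the vector of the parabolic t would commute with it, and by
        -- faithfulness x would commute with t.
        refine hxt (hρ ?_)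
        rw [map_mul, map_mul, hX, hx]
        change toPSL2 (X * (Q * parMat * Q⁻¹)) = toPSL2 (Q * parMat * Q⁻¹ * X)
        congr 1
        have htr' : (Q⁻¹ * X * Q).1.trace = 2 := by
          have := trace_conj Q⁻¹ X
          rw [inv_inv] at this
          rw [this, htr]
        have hfix : (Q⁻¹ * X * Q).1 *ᵥ ![1, 0] = ![1, 0] := by
          rw [SL2.mul_mulVec, SL2.mul_mulVec, hXe, SL2.inv_mulVec_mulVec]
        have hXY : X = Q * (Q⁻¹ * X * Q) * Q⁻¹ := by group
        generalize Q⁻¹ * X * Q = Y at htr' hfix hXY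
        obtain ⟨y0, y1⟩ := SL2.mulVec_apply Y ![1, 0]
        rw [hfix] at y0 y1
        simp at y0 y1
        rw [Matrix.trace_fin_two] at htr'
        have hcomm : Y * parMat = parMat * Y := by
          refine Subtype.ext ?_
          rw [Matrix.SpecialLinearGroup.coe_mul, Matrix.SpecialLinearGroup.coe_mul]
          ext i j
          fin_cases i <;> fin_cases j <;>
            simp [parMat, Matrix.mul_apply, Fin.sum_univ_two, ← y1] <;> linarith
        rw [hXY]
        calc Q * Y * Q⁻¹ * (Q * parMat * Q⁻¹) = Q * (Y * parMat) * Q⁻¹ := by group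
          _ = Q * (parMat * Y) * Q⁻¹ := by rw [hcomm]
          _ = _ := by group
  refine ⟨T, e, hT, hTe, fun x X hx hxt hX htr => ?_⟩
  have hxt' : t ∉ Subgroup.zpowers x := by
    rintro ⟨k, rfl⟩
    exact hxt ((Commute.refl x).zpow_right k)
  rcases hx with ⟨P, l, hl, hx, hU⟩ | ⟨P, hx⟩
  · have hXP : X = P * hypMat l * P⁻¹ := eq_of_toPSL2_eq_of_trace_pos (hX.symm.trans hx) htr (by
      rw [trace_conj, trace_hypMat]; linarith [two_le_two_cosh (l / 2)])
    -- Now t moves the half-plane of x off itself, so e has coordinates of opposite signs in the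
    -- eigenbasis of X, which fixes the sign of the area.
    obtain ⟨h1, h2, h3⟩ := entries_of_disjoint_conj (hU t hxt' T hT.symm)
    have h4 := mul_neg_of_eigenvector (f := (P⁻¹).1 *ᵥ e) h1 h2 h3 (Real.exp_pos _) (by
      rw [SL2.mul_mulVec, SL2.mul_mulVec, SL2.mulVec_inv_mulVec, hTe, Matrix.mulVec_smul])
      (fun h => he (by rw [← SL2.mulVec_inv_mulVec P e, h, Matrix.mulVec_zero]))
    rw [← area_mulVec P⁻¹, hXP, SL2.mul_mulVec, SL2.mul_mulVec, SL2.inv_mulVec_mulVec]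
    set f := (P⁻¹).1 *ᵥ e
    have h5 : Real.exp (-(l / 2)) < Real.exp (l / 2) := Real.exp_lt_exp.2 (by linarith)
    have : area f ((hypMat l).1 *ᵥ f) =
        (Real.exp (-(l / 2)) - Real.exp (l / 2)) * (f 0 * f 1) := by
      obtain ⟨k0, k1⟩ := SL2.mulVec_apply (hypMat l) f
      rw [area, k0, k1]
      simp [hypMat]
      ring
    rw [this]
    exact mul_pos_of_neg_of_neg (by linarith) h4
  · have hXP : X = P * parMat * P⁻¹ := eq_of_toPSL2_eq_of_trace_pos (hX.symm.trans hx) htr (by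
      rw [trace_conj, trace_parMat]; norm_num)
    have hne := hfix x X hxt hX (by rw [hXP, trace_conj, trace_parMat])
    rw [← area_mulVec P⁻¹, hXP, SL2.mul_mulVec, SL2.mul_mulVec, SL2.inv_mulVec_mulVec]
    rw [hXP, SL2.mul_mulVec, SL2.mul_mulVec] at hne
    have hPe := SL2.mulVec_inv_mulVec P e
    set f := (P⁻¹).1 *ᵥ e
    obtain ⟨k0, k1⟩ := SL2.mulVec_apply parMat f
    have : area f (parMat.1 *ᵥ f) = f 1 ^ 2 := by
      rw [area, k0, k1]
      simp [parMat]
      ring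
    rw [this]
    have hf1 : f 1 ≠ 0 := by
      intro hf1
      refine hne ?_
      have : parMat.1 *ᵥ f = f := by
        ext i
        fin_cases i
        · exact k0.trans (by simp [parMat, hf1])
        · exact k1.trans (by simp [parMat])
      rw [this, hPe]
    positivity

/-- A holonomy is determined up to conjugation by its boundary lengths. -/
theorem IsPantsHolonomy.exists_conj {ρ : PantsGroup →* PSL2 ℝ} (h : IsPantsHolonomy ρ) :
    ∃ Q : SL2 ℝ, ∀ y, ρ y = toPSL2 Q * normalRep (hypLength (ρ (bdry 0)))
      (hypLength (ρ (bdry 1))) (hypLength (ρ (bdry 2))) y * (toPSL2 Q)⁻¹ := by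
  obtain ⟨-, R, hR, hRtr⟩ := (h.left 0).exists_lift
  obtain ⟨-, S, hS, hStr⟩ := (h.left 1).exists_lift
  obtain ⟨T, e, hT, hTe, hpos⟩ := (h.left 2).exists_eigenvector h.faithful
  have hRe := hpos _ R (h.left 0) (not_commute_bdry (by decide)) hR
    (by rw [hRtr]; linarith [two_le_two_cosh (hypLength (ρ (bdry 0)) / 2)])
  have hSe := hpos _ S (h.left 1) (not_commute_bdry (by decide)) hS
    (by rw [hStr]; linarith [two_le_two_cosh (hypLength (ρ (bdry 1)) / 2)])
  generalize hypLength (ρ (bdry 0)) = l at *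
  generalize hypLength (ρ (bdry 1)) = m at *
  generalize hypLength (ρ (bdry 2)) = n at *
  have hv : Real.exp (n / 2) * Real.exp (-(n / 2)) = 1 := by rw [← Real.exp_add]; simp
  have hv0 : 0 < Real.exp (n / 2) := Real.exp_pos _
  have hTSR : toPSL2 T = toPSL2 (S * R)⁻¹ := by
    rw [← hT, bdry_two_eq, map_inv, map_mul, hR, hS]
    rfl
  have hRSe : S.1 *ᵥ (R.1 *ᵥ e) = (-Real.exp (n / 2)) • e := by
    have h1 : e = Real.exp (n / 2) • (T.1 *ᵥ e) := by
      rw [hTe, smul_smul, hv, one_smul]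
    rcases (toPSL2_eq_iff _ _).1 hTSR with h2 | h2
    -- Here S R e = v e. Since S preserves area, area(e, R e) = area(S e, v e) = -v area(e, S e),
    -- contradicting the positivity of both areas.
    · exfalso
      have h3 : S.1 *ᵥ (R.1 *ᵥ e) = Real.exp (n / 2) • e := by
        conv_lhs => rw [h1]
        rw [Matrix.mulVec_smul, Matrix.mulVec_smul, ← h2, ← SL2.mul_mulVec,
          SL2.mulVec_inv_mulVec]
      have h4 := area_mulVec S e (R.1 *ᵥ e)
      rw [h3] at h4
      have h5 : area (S.1 *ᵥ e) (Real.exp (n / 2) • e) =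
          -(Real.exp (n / 2) * area e (S.1 *ᵥ e)) := by
        simp [area]; ring
      rw [h5] at h4
      nlinarith [mul_pos hv0 hSe]
    · conv_lhs => rw [h1]
      have h3 : T = -(S * R)⁻¹ := by rw [h2, neg_neg]
      rw [Matrix.mulVec_smul, Matrix.mulVec_smul, h3, Matrix.SpecialLinearGroup.coe_neg,
        Matrix.neg_mulVec, Matrix.mulVec_neg, Matrix.mulVec_neg, ← SL2.mul_mulVec,
        SL2.mulVec_inv_mulVec, smul_neg, neg_smul]
  set f := R.1 *ᵥ e with hf
  have hRf : R.1 *ᵥ f = (2 * Real.cosh (l / 2)) • f - e := by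
    rw [hf, SL2.mulVec_mulVec, hRtr]
  have hSe' : S.1 *ᵥ e = (2 * Real.cosh (m / 2)) • e + Real.exp (-(n / 2)) • f := by
    -- Cayley–Hamilton at f, with S f = -v e, is solved for S e.
    have h1 := SL2.mulVec_mulVec S f
    rw [hRSe, hStr, Matrix.mulVec_smul] at h1
    have h2 : S.1 *ᵥ e = (-Real.exp (-(n / 2))) • ((-Real.exp (n / 2)) • (S.1 *ᵥ e)) := by
      rw [smul_smul, neg_mul_neg, mul_comm, hv, one_smul]
    rw [h2, h1, smul_sub, smul_smul, smul_smul, neg_smul _ f, sub_neg_eq_add]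
    congr 2
    linear_combination (2 * Real.cosh (m / 2)) * hv
  -- The determinant is area(e, R e), so its positivity is what places the conjugator in SL(2, ℝ).
  obtain ⟨Q, k, -, -, hQ⟩ := exists_scaled_conj !![e 0, f 0; e 1, f 1] (by
    rw [Matrix.det_fin_two_of]
    rw [area] at hRe
    linarith)
  have hRQ : R = Q * firstMat (2 * Real.cosh (l / 2)) * Q⁻¹ := by
    refine hQ _ _ ?_
    obtain ⟨a0, a1⟩ := SL2.mulVec_apply R e
    obtain ⟨b0, b1⟩ := SL2.mulVec_apply R f
    rw [← hf] at a0 a1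
    rw [hRf] at b0 b1
    simp at b0 b1
    ext i j
    fin_cases i <;> fin_cases j <;>
      simp [coe_firstMat, Matrix.mul_apply, Fin.sum_univ_two] <;> linarith
  have hSQ : S = Q * secondMat (2 * Real.cosh (m / 2)) (expUnit (n / 2)) * Q⁻¹ := by
    refine hQ _ _ ?_
    obtain ⟨a0, a1⟩ := SL2.mulVec_apply S e
    obtain ⟨b0, b1⟩ := SL2.mulVec_apply S f
    rw [hSe'] at a0 a1
    rw [hRSe] at b0 b1
    simp at a0 a1 b0 b1
    ext i j
    fin_cases i <;> fin_cases j <;>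
      simp [coe_secondMat, val_expUnit, val_inv_expUnit, Matrix.mul_apply, Fin.sum_univ_two,
        -Units.val_inv_eq_inv_val] <;> linarith
  have hall : ρ = (MulAut.conj (toPSL2 Q)).toMonoidHom.comp (normalRep l m n) := by
    refine pantsGroup_hom_ext ?_ ?_
    · rw [MonoidHom.comp_apply, normalRep_apply, normalForm, pantsHom_bdry_zero, hR, hRQ]
      rfl
    · rw [MonoidHom.comp_apply, normalRep_apply, normalForm, pantsHom_bdry_one, hS, hSQ]
      rfl
  exact ⟨Q, fun y => DFunLike.congr_fun hall y⟩

/-! ### The algebra `𝓑` and the group `PSL(2, 𝓑)` -/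

/-- The element `a e⁺ + b e⁻` of `𝓑`. -/
def ofCoords (a b : ℝ) : BAlg := ⟨(a + b) / 2, (a - b) / 2⟩

@[simp] theorem coordPlus_ofCoords (a b : ℝ) : coordPlus (ofCoords a b) = a := by
  change (a + b) / 2 + (a - b) / 2 = a
  ring

@[simp] theorem coordMinus_ofCoords (a b : ℝ) : coordMinus (ofCoords a b) = b := by
  change (a + b) / 2 - (a - b) / 2 = b
  ring

theorem BAlg.ext_coords {x y : BAlg} (h1 : coordPlus x = coordPlus y)
    (h2 : coordMinus x = coordMinus y) : x = y := by
  change x.re + x.im = y.re + y.im at h1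
  change x.re - x.im = y.re - y.im at h2
  ext <;> linarith

theorem continuous_re : Continuous (fun z : BAlg => z.re) :=
  continuous_fst.comp (continuous_induced_dom (f := fun z : BAlg => (z.re, z.im)))

theorem continuous_im : Continuous (fun z : BAlg => z.im) :=
  continuous_snd.comp (continuous_induced_dom (f := fun z : BAlg => (z.re, z.im)))

theorem continuous_coordPlus : Continuous coordPlus := continuous_re.add continuous_im

theorem continuous_coordMinus : Continuous coordMinus := continuous_re.sub continuous_im

theorem continuous_bAlg_iff {X : Type*} [TopologicalSpace X] {f : X → BAlg} :
    Continuous f ↔ Continuous (fun x => coordPlus (f x)) ∧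
      Continuous (fun x => coordMinus (f x)) := by
  refine ⟨fun h => ⟨continuous_coordPlus.comp h, continuous_coordMinus.comp h⟩, fun h => ?_⟩
  rw [continuous_induced_rng]
  have h1 : (fun z : BAlg => (z.re, z.im)) ∘ f = fun x =>
      ((coordPlus (f x) + coordMinus (f x)) / 2, (coordPlus (f x) - coordMinus (f x)) / 2) := by
    funext x
    change ((f x).re, (f x).im) = (((f x).re + (f x).im + ((f x).re - (f x).im)) / 2,
      ((f x).re + (f x).im - ((f x).re - (f x).im)) / 2)
    congr 1 <;> ring
  rw [h1]
  exact ((h.1.add h.2).div_const 2).prodMk ((h.1.sub h.2).div_const 2)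

instance : IsTopologicalRing BAlg where
  continuous_add := by
    rw [continuous_bAlg_iff]
    simp only [map_add]
    exact ⟨(continuous_coordPlus.comp continuous_fst).add (continuous_coordPlus.comp continuous_snd),
      (continuous_coordMinus.comp continuous_fst).add (continuous_coordMinus.comp continuous_snd)⟩
  continuous_mul := by
    rw [continuous_bAlg_iff]
    simp only [map_mul]
    exact ⟨(continuous_coordPlus.comp continuous_fst).mul (continuous_coordPlus.comp continuous_snd),
      (continuous_coordMinus.comp continuous_fst).mul (continuous_coordMinus.comp continuous_snd)⟩
  continuous_neg := by
    rw [continuous_bAlg_iff]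
    simp only [map_neg]
    exact ⟨continuous_coordPlus.neg, continuous_coordMinus.neg⟩

/-- The norm is the product of the idempotent coordinates and the real part is their mean. -/
theorem mem_conePlus_iff (z : BAlg) : z ∈ conePlus ↔ 0 < coordPlus z ∧ 0 < coordMinus z := by
  have hn : QuadraticAlgebra.norm z = coordPlus z * coordMinus z := by
    change _ = (z.re + z.im) * (z.re - z.im)
    simp [QuadraticAlgebra.norm]
    ring
  have hr : z.re = (coordPlus z + coordMinus z) / 2 := by
    change _ = (z.re + z.im + (z.re - z.im)) / 2
    ring
  change 0 < z.re ∧ 0 < QuadraticAlgebra.norm z ↔ _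
  rw [hn, hr]
  constructor
  · rintro ⟨h1, h2⟩
    rcases pos_and_pos_or_neg_and_neg_of_mul_pos h2 with h | h
    · exact h
    · linarith
  · rintro ⟨h1, h2⟩
    exact ⟨by linarith, mul_pos h1 h2⟩

theorem mem_closure_conePlus_iff (z : BAlg) :
    z ∈ closure conePlus ↔ 0 ≤ coordPlus z ∧ 0 ≤ coordMinus z := by
  constructor
  · have hc : IsClosed {z : BAlg | 0 ≤ coordPlus z ∧ 0 ≤ coordMinus z} :=
      (isClosed_le continuous_const continuous_coordPlus).inter
        (isClosed_le continuous_const continuous_coordMinus)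
    have hsub : conePlus ⊆ {z : BAlg | 0 ≤ coordPlus z ∧ 0 ≤ coordMinus z} := fun w hw =>
      ((mem_conePlus_iff w).1 hw).imp le_of_lt le_of_lt
    exact fun h => closure_minimal hsub hc h
  · rintro ⟨h1, h2⟩
    have hf : Continuous (fun ε : ℝ => z + ofCoords ε ε) := by
      rw [continuous_bAlg_iff]
      simp only [map_add, coordPlus_ofCoords, coordMinus_ofCoords]
      exact ⟨by fun_prop, by fun_prop⟩
    have h0 : z + ofCoords 0 0 = z := BAlg.ext_coords (by simp) (by simp)
    have ht : Filter.Tendsto (fun ε : ℝ => z + ofCoords ε ε) (𝓝[>] 0) (𝓝 z) := by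
      have := hf.tendsto 0
      rw [h0] at this
      exact this.mono_left nhdsWithin_le_nhds
    refine mem_closure_of_tendsto ht (eventually_nhdsWithin_of_forall fun ε hε => ?_)
    rw [mem_conePlus_iff]
    simp only [map_add, coordPlus_ofCoords, coordMinus_ofCoords]
    rw [Set.mem_Ioi] at hε
    exact ⟨by linarith, by linarith⟩

theorem projPlus_toPSL2 (M : SL2 BAlg) :
    projPlus (toPSL2 M) = toPSL2 (Matrix.SpecialLinearGroup.map coordPlus M) := rfl

theorem projMinus_toPSL2 (M : SL2 BAlg) :
    projMinus (toPSL2 M) = toPSL2 (Matrix.SpecialLinearGroup.map coordMinus M) := rfl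

/-- Independent signs in the two components combine into the four central scalars ±1, ±τ, so the
quotient by the centre is exactly the product. -/
theorem PSL2.ext_proj {A B : PSL2 BAlg} (h1 : projPlus A = projPlus B)
    (h2 : projMinus A = projMinus B) : A = B := by
  suffices h : A⁻¹ * B = 1 from (inv_mul_eq_one.1 h)
  have e1 : projPlus (A⁻¹ * B) = 1 := by rw [map_mul, map_inv, h1, inv_mul_cancel]
  have e2 : projMinus (A⁻¹ * B) = 1 := by rw [map_mul, map_inv, h2, inv_mul_cancel]
  generalize A⁻¹ * B = g at e1 e2
  obtain ⟨M, rfl⟩ := QuotientGroup.mk_surjective g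
  rw [QuotientGroup.eq_one_iff, Matrix.SpecialLinearGroup.mem_center_iff]
  rw [projPlus_toPSL2, QuotientGroup.eq_one_iff, Matrix.SpecialLinearGroup.mem_center_iff] at e1
  rw [projMinus_toPSL2, QuotientGroup.eq_one_iff, Matrix.SpecialLinearGroup.mem_center_iff] at e2
  obtain ⟨c, hc, e1⟩ := e1
  obtain ⟨d, hd, e2⟩ := e2
  refine ⟨ofCoords c d, BAlg.ext_coords (by simpa using hc) (by simpa using hd), ?_⟩
  refine Matrix.ext fun i j => ?_
  have f1 := congrFun (congrFun e1 i) j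
  have f2 := congrFun (congrFun e2 i) j
  rw [Matrix.SpecialLinearGroup.map_apply_coe] at f1 f2
  refine BAlg.ext_coords ?_ ?_
  · refine Eq.trans ?_ f1
    fin_cases i <;> fin_cases j <;> simp
  · refine Eq.trans ?_ f2
    fin_cases i <;> fin_cases j <;> simp

theorem exists_proj_eq (P Q : SL2 ℝ) :
    ∃ A : PSL2 BAlg, projPlus A = toPSL2 P ∧ projMinus A = toPSL2 Q := by
  have hdet : (Matrix.of fun i j => ofCoords (P i j) (Q i j)).det = 1 := by
    rw [Matrix.det_fin_two]
    refine BAlg.ext_coords ?_ ?_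
    · simpa using P.det_eq
    · simpa using Q.det_eq
  obtain ⟨M, hM⟩ : ∃ M : SL2 BAlg, ∀ i j, M i j = ofCoords (P i j) (Q i j) :=
    ⟨⟨_, hdet⟩, fun _ _ => rfl⟩
  refine ⟨toPSL2 M, ?_, ?_⟩
  · rw [projPlus_toPSL2]
    congr 1
    ext i j
    rw [Matrix.SpecialLinearGroup.map_apply_coe, RingHom.mapMatrix_apply, Matrix.map_apply, hM,
      coordPlus_ofCoords]
  · rw [projMinus_toPSL2]
    congr 1
    ext i j
    rw [Matrix.SpecialLinearGroup.map_apply_coe, RingHom.mapMatrix_apply, Matrix.map_apply, hM,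
      coordMinus_ofCoords]

/-! ### Continuity -/

theorem continuous_mapPSL2 {R S : Type} [CommRing R] [CommRing S] [TopologicalSpace R]
    [TopologicalSpace S] (f : R →+* S) (hf : Continuous f) : Continuous (mapPSL2 f) := by
  refine continuous_quot_lift _ (continuous_quot_mk.comp ?_)
  refine Continuous.subtype_mk ?_ _
  refine continuous_matrix fun i j => ?_
  exact hf.comp (continuous_subtype_val.matrix_elem i j)

theorem continuous_absTrace : Continuous absTrace :=
  continuous_quot_lift _ (continuous_abs.comp continuous_subtype_val.matrix_trace)

theorem bLength_coordPlus (A : PSL2 BAlg) : coordPlus (bLength A) = hypLength (projPlus A) :=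
  coordPlus_ofCoords _ _

theorem bLength_coordMinus (A : PSL2 BAlg) : coordMinus (bLength A) = hypLength (projMinus A) :=
  coordMinus_ofCoords _ _

/-- Keeps the argument of arcosh in [1, ∞), where `Real.continuousOn_arcosh` applies. -/
theorem SurfaceOnLeft.two_le_absTrace {G : Type} [Group G] {ρ : G →* PSL2 ℝ} {x : G}
    (h : SurfaceOnLeft ρ x) : 2 ≤ absTrace (ρ x) := by
  obtain ⟨-, X, hX, htr⟩ := h.exists_lift
  rw [hX]
  change 2 ≤ |X.1.trace|
  rw [htr]
  exact (two_le_two_cosh _).trans (le_abs_self _)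

theorem continuous_hypLength_of_surfaceOnLeft {X G : Type} [TopologicalSpace X] [Group G]
    {ρ : X → G →* PSL2 ℝ} {x : G} (hρ : Continuous fun a => ρ a x)
    (h : ∀ a, SurfaceOnLeft (ρ a) x) : Continuous fun a => hypLength (ρ a x) := by
  refine continuous_const.mul (Real.continuousOn_arcosh.comp_continuous
    ((continuous_absTrace.comp hρ).div_const 2) fun a => ?_)
  rw [Set.mem_Ici]
  linarith [(h a).two_le_absTrace]

theorem continuous_apply_admHom (x : PantsGroup) : Continuous fun ρ : AdmHom => ρ.1 x :=
  (continuous_apply x).comp continuous_induced_dom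

theorem continuous_bLength_bdry (i : Fin 3) :
    Continuous fun ρ : AdmHom => bLength (ρ.1 (bdry i)) := by
  rw [continuous_bAlg_iff]
  simp only [bLength_coordPlus, bLength_coordMinus]
  constructor
  · exact continuous_hypLength_of_surfaceOnLeft (ρ := fun ρ : AdmHom => projPlus.comp ρ.1)
      ((continuous_mapPSL2 _ continuous_coordPlus).comp (continuous_apply_admHom _))
      fun ρ => ρ.2.plus.left i
  · exact continuous_hypLength_of_surfaceOnLeft (ρ := fun ρ : AdmHom => projMinus.comp ρ.1)
      ((continuous_mapPSL2 _ continuous_coordMinus).comp (continuous_apply_admHom _))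
      fun ρ => ρ.2.minus.left i

/-! ### The length map and its inverse -/

theorem hypLength_conj (Q : SL2 ℝ) (A : PSL2 ℝ) :
    hypLength (toPSL2 Q * A * (toPSL2 Q)⁻¹) = hypLength A := by
  obtain ⟨M, rfl⟩ := QuotientGroup.mk_surjective A
  change hypLength (toPSL2 (Q * M * Q⁻¹)) = hypLength (toPSL2 M)
  rw [hypLength_toPSL2, hypLength_toPSL2, trace_conj]

theorem bLength_conj (g A : PSL2 BAlg) : bLength (g * A * g⁻¹) = bLength A := by
  obtain ⟨M, rfl⟩ := QuotientGroup.mk_surjective g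
  refine BAlg.ext_coords ?_ ?_
  · rw [bLength_coordPlus, bLength_coordPlus, map_mul, map_mul, map_inv]
    exact hypLength_conj _ _
  · rw [bLength_coordMinus, bLength_coordMinus, map_mul, map_mul, map_inv]
    exact hypLength_conj _ _

theorem bLength_mem_closure (ρ : AdmHom) (i : Fin 3) :
    bLength (ρ.1 (bdry i)) ∈ closure conePlus := by
  rw [mem_closure_conePlus_iff, bLength_coordPlus, bLength_coordMinus]
  exact ⟨(ρ.2.plus.left i).exists_lift.1, (ρ.2.minus.left i).exists_lift.1⟩

/-- The map sending a class of admissible representations to its boundary `𝓑`-lengths. -/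
def lengthMap : AdmModuli → Fin 3 → closure conePlus :=
  Quotient.lift (fun ρ i => ⟨bLength (ρ.1 (bdry i)), bLength_mem_closure ρ i⟩) (by
    rintro ρ σ ⟨g, h⟩
    funext i
    refine Subtype.ext ?_
    change bLength (ρ.1 (bdry i)) = bLength (σ.1 (bdry i))
    rw [h, bLength_conj])

theorem continuous_lengthMap : Continuous lengthMap :=
  continuous_quot_lift _ (continuous_pi fun i => (continuous_bLength_bdry i).subtype_mk _)

/-- In each factor both representations are conjugate to the same normal form; the two real
conjugators assemble into one over 𝓑. -/
theorem lengthMap_injective : Function.Injective lengthMap := by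
  intro p q hpq
  induction p, q using Quotient.inductionOn₂ with | _ ρ σ
  have hb : ∀ i, bLength (ρ.1 (bdry i)) = bLength (σ.1 (bdry i)) := fun i =>
    congrArg Subtype.val (congrFun hpq i)
  have hplus : ∀ i, hypLength (projPlus (ρ.1 (bdry i))) = hypLength (projPlus (σ.1 (bdry i))) :=
    fun i => by rw [← bLength_coordPlus, ← bLength_coordPlus, hb]
  have hminus : ∀ i, hypLength (projMinus (ρ.1 (bdry i))) = hypLength (projMinus (σ.1 (bdry i))) :=
    fun i => by rw [← bLength_coordMinus, ← bLength_coordMinus, hb]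
  obtain ⟨P, hP⟩ := ρ.2.plus.exists_conj
  obtain ⟨P', hP'⟩ := σ.2.plus.exists_conj
  obtain ⟨Q, hQ⟩ := ρ.2.minus.exists_conj
  obtain ⟨Q', hQ'⟩ := σ.2.minus.exists_conj
  simp only [MonoidHom.comp_apply, hplus, hminus] at hP hP' hQ hQ'
  obtain ⟨g, hg1, hg2⟩ := exists_proj_eq (P' * P⁻¹) (Q' * Q⁻¹)
  refine Quotient.sound ⟨g, fun y => PSL2.ext_proj ?_ ?_⟩
  · rw [map_mul, map_mul, map_inv, hg1, hP, hP']
    change _ = toPSL2 P' * (toPSL2 P)⁻¹ * _ * (toPSL2 P' * (toPSL2 P)⁻¹)⁻¹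
    group
  · rw [map_mul, map_mul, map_inv, hg2, hQ, hQ']
    change _ = toPSL2 Q' * (toPSL2 Q)⁻¹ * _ * (toPSL2 Q' * (toPSL2 Q)⁻¹)⁻¹
    group

/-! ### The normal form over 𝓑 and the continuous inverse. -/

/-- Twice the hyperbolic cosine of half of an element of `𝓑`. -/
def twoCosh (z : BAlg) : BAlg :=
  ofCoords (2 * Real.cosh (coordPlus z / 2)) (2 * Real.cosh (coordMinus z / 2))

/-- The exponential of half of an element of `𝓑`, as a unit. -/
def expHalf (z : BAlg) : BAlgˣ where
  val := ofCoords (expUnit (coordPlus z / 2)) (expUnit (coordMinus z / 2))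
  inv := ofCoords ((expUnit (coordPlus z / 2))⁻¹ : ℝˣ) ((expUnit (coordMinus z / 2))⁻¹ : ℝˣ)
  val_inv := BAlg.ext_coords (by simp) (by simp)
  inv_val := BAlg.ext_coords (by simp) (by simp)

theorem map_comp_normalForm {A B : Type} [CommRing A] [CommRing B] (f : A →+* B) (x y : A)
    (v : Aˣ) : (Matrix.SpecialLinearGroup.map f).comp (normalForm x y v) =
      normalForm (f x) (f y) (Units.map f v) := by
  refine pantsGroup_hom_ext ?_ ?_
  · rw [MonoidHom.comp_apply, normalForm, normalForm, pantsHom_bdry_zero, pantsHom_bdry_zero]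
    ext i j
    rw [Matrix.SpecialLinearGroup.map_apply_coe]
    fin_cases i <;> fin_cases j <;> simp [coe_firstMat]
  · rw [MonoidHom.comp_apply, normalForm, normalForm, pantsHom_bdry_one, pantsHom_bdry_one]
    ext i j
    rw [Matrix.SpecialLinearGroup.map_apply_coe]
    fin_cases i <;> fin_cases j <;> simp [coe_secondMat]

/-- The representation in `PSL(2, 𝓑)` with given boundary `𝓑`-lengths. -/
def normalRepB (L : Fin 3 → BAlg) : PantsGroup →* PSL2 BAlg :=
  (QuotientGroup.mk' _).comp (normalForm (twoCosh (L 0)) (twoCosh (L 1)) (expHalf (L 2)))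

theorem projPlus_comp_normalRepB (L : Fin 3 → BAlg) : projPlus.comp (normalRepB L) =
    normalRep (coordPlus (L 0)) (coordPlus (L 1)) (coordPlus (L 2)) := by
  have h := map_comp_normalForm coordPlus (twoCosh (L 0)) (twoCosh (L 1)) (expHalf (L 2))
  have hv : Units.map coordPlus (expHalf (L 2)) = expUnit (coordPlus (L 2) / 2) :=
    Units.ext (coordPlus_ofCoords _ _)
  rw [hv, twoCosh, twoCosh, coordPlus_ofCoords, coordPlus_ofCoords] at h
  rw [normalRep, ← h]
  rfl

theorem projMinus_comp_normalRepB (L : Fin 3 → BAlg) : projMinus.comp (normalRepB L) =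
    normalRep (coordMinus (L 0)) (coordMinus (L 1)) (coordMinus (L 2)) := by
  have h := map_comp_normalForm coordMinus (twoCosh (L 0)) (twoCosh (L 1)) (expHalf (L 2))
  have hv : Units.map coordMinus (expHalf (L 2)) = expUnit (coordMinus (L 2) / 2) :=
    Units.ext (coordMinus_ofCoords _ _)
  rw [hv, twoCosh, twoCosh, coordMinus_ofCoords, coordMinus_ofCoords] at h
  rw [normalRep, ← h]
  rfl

theorem SurfaceOnLeft.isHyp_or_isPar {G : Type} [Group G] {ρ : G →* PSL2 ℝ} {x : G}
    (h : SurfaceOnLeft ρ x) : IsHyp (ρ x) ∨ IsPar (ρ x) := by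
  rcases h with ⟨P, l, hl, hx, -⟩ | ⟨P, hx⟩
  · refine .inl ⟨_, hx.symm, ?_⟩
    rw [Matrix.IsHyperbolic, Matrix.discr_fin_two, trace_conj, trace_hypMat,
      Matrix.SpecialLinearGroup.det_coe]
    nlinarith [Real.one_lt_cosh.2 (half_pos hl).ne']
  · refine .inr ⟨_, hx.symm, ?_, ?_⟩
    -- A scalar c would give c P = P `parMat`, forcing the first column of P to vanish.
    · rintro ⟨c, hc⟩
      have h1 : (P * parMat * P⁻¹).1 * P.1 = P.1 * parMat.1 := by
        rw [← Matrix.SpecialLinearGroup.coe_mul, inv_mul_cancel_right,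
          Matrix.SpecialLinearGroup.coe_mul]
      rw [← hc] at h1
      have e0 := congrFun (congrFun h1 0) 0
      have e1 := congrFun (congrFun h1 0) 1
      have e2 := congrFun (congrFun h1 1) 0
      have e3 := congrFun (congrFun h1 1) 1
      simp [parMat, Matrix.mul_apply, Fin.sum_univ_two] at e0 e1 e2 e3
      have hd := SL2.det_eq P
      grind
    · rw [Matrix.discr_fin_two, trace_conj, trace_parMat, Matrix.SpecialLinearGroup.det_coe]
      norm_num

theorem isAdmissible_normalRepB (L : Fin 3 → closure conePlus) :
    IsAdmissible (normalRepB fun i => L i) := by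
  have h := fun i => (mem_closure_conePlus_iff _).1 (L i).2
  have hplus : IsPantsHolonomy (projPlus.comp (normalRepB fun i => L i)) := by
    rw [projPlus_comp_normalRepB]
    exact isPantsHolonomy_normalRep (h 0).1 (h 1).1 (h 2).1
  have hminus : IsPantsHolonomy (projMinus.comp (normalRepB fun i => L i)) := by
    rw [projMinus_comp_normalRepB]
    exact isPantsHolonomy_normalRep (h 0).2 (h 1).2 (h 2).2
  refine ⟨fun i => ?_, hplus, hminus⟩
  rcases (hplus.left i).isHyp_or_isPar with h1 | h1 <;>
    rcases (hminus.left i).isHyp_or_isPar with h2 | h2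
  · exact .inl ⟨h1, h2⟩
  · exact .inr (.inl (.inl ⟨h1, h2⟩))
  · exact .inr (.inl (.inr ⟨h1, h2⟩))
  · exact .inr (.inr ⟨h1, h2⟩)

/-- The admissible representation in normal form with given boundary `𝓑`-lengths. -/
def admOfLengths (L : Fin 3 → closure conePlus) : AdmHom :=
  ⟨normalRepB fun i => L i, isAdmissible_normalRepB L⟩

/-- The class of admissible representations with given boundary `𝓑`-lengths. -/
def ofLengths (L : Fin 3 → closure conePlus) : AdmModuli :=
  Quotient.mk conjSetoid (admOfLengths L)

/-- The generators have entries continuous in the lengths, including where some vanish, and group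
operations preserve continuity. -/
theorem continuous_normalRepB (y : PantsGroup) :
    Continuous fun L : Fin 3 → BAlg => normalRepB L y := by
  have hmat : ∀ {f : (Fin 3 → BAlg) → SL2 BAlg}, (∀ i j, Continuous fun L => f L i j) →
      Continuous f := fun h => continuous_induced_rng.2 (continuous_matrix h)
  have hcosh : ∀ i, Continuous fun L : Fin 3 → BAlg => twoCosh (L i) := by
    intro i
    have h1 := continuous_coordPlus.comp (continuous_apply (A := fun _ : Fin 3 => BAlg) i)
    have h2 := continuous_coordMinus.comp (continuous_apply (A := fun _ : Fin 3 => BAlg) i)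
    rw [continuous_bAlg_iff]
    simp only [twoCosh, coordPlus_ofCoords, coordMinus_ofCoords]
    exact ⟨continuous_const.mul (Real.continuous_cosh.comp (h1.div_const 2)),
      continuous_const.mul (Real.continuous_cosh.comp (h2.div_const 2))⟩
  have h1 := continuous_coordPlus.comp (continuous_apply (A := fun _ : Fin 3 => BAlg) 2)
  have h2 := continuous_coordMinus.comp (continuous_apply (A := fun _ : Fin 3 => BAlg) 2)
  have hexp : Continuous fun L : Fin 3 → BAlg => (expHalf (L 2) : BAlg) := by
    rw [continuous_bAlg_iff]
    simp only [expHalf, coordPlus_ofCoords, coordMinus_ofCoords]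
    exact ⟨Real.continuous_exp.comp (h1.div_const 2), Real.continuous_exp.comp (h2.div_const 2)⟩
  have hexp' : Continuous fun L : Fin 3 → BAlg => ((expHalf (L 2))⁻¹ : BAlgˣ).val := by
    have : ∀ z, ((expHalf z)⁻¹ : BAlgˣ).val =
      ofCoords (Real.exp (-(coordPlus z / 2))) (Real.exp (-(coordMinus z / 2))) := fun _ => rfl
    rw [continuous_bAlg_iff]
    simp only [this, coordPlus_ofCoords, coordMinus_ofCoords]
    exact ⟨Real.continuous_exp.comp (h1.div_const 2).neg,
      Real.continuous_exp.comp (h2.div_const 2).neg⟩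
  suffices h : Continuous fun L : Fin 3 → BAlg =>
      normalForm (twoCosh (L 0)) (twoCosh (L 1)) (expHalf (L 2)) y from continuous_quot_mk.comp h
  have hy : y ∈ Subgroup.closure {bdry 0, bdry 1} := closure_bdry ▸ Subgroup.mem_top y
  induction hy using Subgroup.closure_induction with
  | mem y hy =>
    rcases hy with rfl | rfl
    · simp only [normalForm, pantsHom_bdry_zero]
      refine hmat fun i j => ?_
      have := hcosh 0
      fin_cases i <;> fin_cases j <;> simp [coe_firstMat] <;> fun_prop
    · simp only [normalForm, pantsHom_bdry_one]
      refine hmat fun i j => ?_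
      have := hcosh 1
      fin_cases i <;> fin_cases j <;> simp [coe_secondMat] <;> fun_prop
  | one => simpa only [map_one] using continuous_const
  | mul a b _ _ ha hb => simp only [map_mul]; exact ha.mul hb
  | inv a _ ha => simp only [map_inv]; exact ha.inv

theorem continuous_ofLengths : Continuous ofLengths := by
  have h : Continuous admOfLengths := by
    refine continuous_induced_rng.2 (continuous_pi fun y => ?_)
    have hL : Continuous fun (L : Fin 3 → closure conePlus) (i : Fin 3) => (L i : BAlg) :=
      continuous_pi fun i => continuous_subtype_val.comp (continuous_apply i)
    have h2 : Continuous fun L : Fin 3 → closure conePlus => normalRepB (fun i => L i) y :=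
      Continuous.comp (g := fun L => normalRepB L y) (continuous_normalRepB y) hL
    exact h2
  exact continuous_quot_mk.comp h

theorem hypLength_normalRep {l m n : ℝ} (hl : 0 ≤ l) (hm : 0 ≤ m) (hn : 0 ≤ n) (i : Fin 3) :
    hypLength (normalRep l m n (bdry i)) = ![l, m, n] i := by
  have hc := fun a => two_le_two_cosh a
  fin_cases i
  · change hypLength (normalRep l m n (bdry 0)) = l
    rw [normalRep_apply, normalForm, pantsHom_bdry_zero]
    refine hypLength_of_abs_trace hl ?_
    rw [coe_firstMat, Matrix.trace_fin_two_of, zero_add, abs_of_nonneg (by linarith [hc (l / 2)])]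
  · change hypLength (normalRep l m n (bdry 1)) = m
    rw [normalRep_apply, normalForm, pantsHom_bdry_one]
    refine hypLength_of_abs_trace hm ?_
    rw [coe_secondMat, Matrix.trace_fin_two_of, add_zero, abs_of_nonneg (by linarith [hc (m / 2)])]
  · change hypLength (normalRep l m n (bdry 2)) = n
    rw [normalRep_apply, normalForm, pantsHom_bdry_two]
    refine hypLength_of_abs_trace hn ?_
    obtain ⟨e1, -, -, e2⟩ := SL2.inv_apply (secondMat (2 * Real.cosh (m / 2)) (expUnit (n / 2)) *
      firstMat (2 * Real.cosh (l / 2)))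
    rw [Matrix.trace_fin_two, e1, e2, Matrix.SpecialLinearGroup.coe_mul, coe_firstMat,
      coe_secondMat, val_expUnit, val_inv_expUnit, Real.cosh_eq (n / 2)]
    simp [Matrix.mul_apply, Fin.sum_univ_two]
    -- The product of the two matrices is triangular with diagonal -v, -v⁻¹, hence the negative
    -- trace.
    rw [abs_of_neg (by linarith [Real.exp_pos (n / 2), Real.exp_pos (-(n / 2))])]
    ring

theorem lengthMap_ofLengths (L : Fin 3 → closure conePlus) : lengthMap (ofLengths L) = L := by
  funext i
  refine Subtype.ext ?_
  change bLength (normalRepB (fun i => L i) (bdry i)) = L i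
  have h := fun i => (mem_closure_conePlus_iff _).1 (L i).2
  refine BAlg.ext_coords ?_ ?_
  · rw [bLength_coordPlus, ← MonoidHom.comp_apply, projPlus_comp_normalRepB,
      hypLength_normalRep (h 0).1 (h 1).1 (h 2).1]
    fin_cases i <;> rfl
  · rw [bLength_coordMinus, ← MonoidHom.comp_apply, projMinus_comp_normalRepB,
      hypLength_normalRep (h 0).2 (h 1).2 (h 2).2]
    fin_cases i <;> rfl

/-- The boundary `𝓑`-lengths as a homeomorphism. -/
def lengthHomeomorph : AdmModuli ≃ₜ (Fin 3 → closure conePlus) where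
  toFun := lengthMap
  invFun := ofLengths
  left_inv p := lengthMap_injective (lengthMap_ofLengths (lengthMap p))
  right_inv := lengthMap_ofLengths
  continuous_toFun := continuous_lengthMap
  continuous_invFun := continuous_ofLengths

end AdSPants

end

theorem mainTheorem5 :
    ∃ F : AdSPants.AdmModuli ≃ₜ (Fin 3 → closure AdSPants.conePlus),
      ∀ (ρ : AdSPants.AdmHom) (i : Fin 3),
        (F (Quotient.mk AdSPants.conjSetoid ρ) i : AdSPants.BAlg) =
          AdSPants.bLength (ρ.1 (AdSPants.bdry i)) :=
  ⟨AdSPants.lengthHomeomorph, fun _ _ => rfl⟩
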